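/- Let $\mathcal C\subset\mathbb R^d$ be a bounded convex set with nonempty interior, and let $\mathcal P_2(\mathcal C)$ be the set of Borel probability measures on $\mathbb R^d$ that are concentrated on $\mathcal C$ (their second moments are automatically finite). Let $U:\mathcal C\to\mathbb R$ be differentiable on $\mathcal C$ (relative to $\mathcal C$ at boundary points) with $\|\nabla U(x)-\nabla U(y)\|\le C_1\|x-y\|$ for all $x,y\in\mathcal C$, and suppose $|U(x_0)|\le C_0$, $\|\nabla U(x_0)\|\le C_2$ at some $x_0\in\mathcal C$. For $\epsilon>0$ put $\varphi_\epsilon(x)=\exp(-\|x\|^2/(2\epsilon))$ and $$F^\epsilon[\rho]=\int_{\mathcal C}\bigl(U(x)+\ln((\varphi_\epsilon*\rho)(x))\bigr)\,d\rho(x),\qquad \rho\in\mathcal P_2(\mathcal C).$$ Definitions, for a functional $F:\mathcal P_2(\mathcal C)\to\mathbb R$ and $\rho\in\mathcal P_2(\mathcal C)$: - A *first variation* of $F$ at $\rho$ is a function $f=\frac{\delta F}{\delta\rho}\big|_\rho$, integrable with respect to every $\nu\in\mathcal P_2(\mathcal C)$, such that $\int f\,d(\nu-\rho)=\frac{d}{ds}F[(1-s)\rho+s\nu]\big|_{s=0^+}$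 for all $\nu\in\mathcal P_2(\mathcal C)$. - A *Wasserstein gradient* of $F$ at $\rho$ is a $\xi\in L^2(\rho;\mathbb R^d)$ such that, for all $\nu\in\mathcal P_2(\mathcal C)$, $F[\nu]=F[\rho]+\int\langle\xi(x),y-x\rangle\,d\pi(x,y)+o(W_2(\rho,\nu))$ for some optimal transport plan $\pi$ from $\rho$ to $\nu$ (quadratic cost). $F$ is *Wasserstein-differentiable* at $\rho$ if one exists. Its tangential representative, if there is one, is the Wasserstein gradient that lies in the tangent space $\mathrm{Tan}_\rho$, the closure of $\{\nabla\phi:\phi\in C_c^\infty(\mathbb R^d)\}$ in $L^2(\rho;\mathbb R^d)$. - Fix an atomless Borel probability measure $P$ on a Polish space, and let $L^2(P;\mathcal C)$ be the set of $X\in L^2(P;\mathbb R^d)$ with values in $\mathcal C$. $F$ is *L-differentiable* (Lions-differentiable) at $\rho$ if the lift $\tilde F(X)=F[X_\#P]$ on $L^2(P;\mathcal C)$ is Fréchet differentiable (relative to $L^2(P;\mathcal C)$) at some $X$ with $X_\#P=\rho$. An *L-derivative* of $F$ at $\rho$ is a $\xi\in L^2(\rho;\mathbb R^d)$ such that at every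 $X\in L^2(P;\mathcal C)$ with $X_\#P=\rho$, $\tilde F$ is Fréchet differentiable with derivative $\xi\circ X$. **Theorem.** For every $\rho\in\mathcal P_2(\mathcal C)$, the integral defining $F^\epsilon[\rho]$ converges, $F^\epsilon$ has a first variation at $\rho$, and $F^\epsilon$ is both L-differentiable and Wasserstein-differentiable at $\rho$. The two gradients coincide and equal the gradient of the first variation, $$\nabla_WF^\epsilon[\rho]=\partial_\rho F^\epsilon[\rho]=\nabla\tfrac{\delta F^\epsilon}{\delta\rho}\Big|_\rho.$$ That is, there is a vector field $\xi$ such that every first variation $f$ of $F^\epsilon$ at $\rho$ is differentiable on $\mathcal C$ (relative to $\mathcal C$) with $\nabla f(x)=\xi(x)$ for all $x\in\mathcal C$; $\xi$ is an L-derivative of $F^\epsilon$ at $\rho$, and any other one equals $\xi$ $\rho$-a.e.; and $\xi$ is a Wasserstein gradient of $F^\epsilon$ at $\rho$, lies in $\mathrm{Tan}_\rho$, and equals $\rho$-a.e. every Wasserstein gradient of $F^\epsilon$ at $\rho$ in $\mathrm{Tan}_\rho$. -/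

import Mathlib

open MeasureTheory Set Filter Topology
open scoped ENNReal

namespace RegKL

/-- The Euclidean space `ℝᵈ`. -/
abbrev Euc (d : ℕ) : Type := EuclideanSpace ℝ (Fin d)

/-- `𝒫₂(C)`: Borel probability measures on `ℝᵈ` that are concentrated on `C` and have finite
second moment. -/
def P2 {d : ℕ} (C : Set (Euc d)) : Set (Measure (Euc d)) :=
  {μ | IsProbabilityMeasure μ ∧ μ Cᶜ = 0 ∧ ∫⁻ x, ‖x‖ₑ ^ 2 ∂μ < ∞}

/-- `Π(μ, ν)`: the couplings of `μ` and `ν`. For `μ, ν ∈ 𝒫₂(C)` they are automatically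
concentrated on `C × C`. -/
def couplings {d : ℕ} (μ ν : Measure (Euc d)) : Set (Measure (Euc d × Euc d)) :=
  {γ | γ.map Prod.fst = μ ∧ γ.map Prod.snd = ν}

/-- `(∫ |x - y|² dγ)^{1/2}`. -/
noncomputable def transportCost {d : ℕ} (γ : Measure (Euc d × Euc d)) : ℝ≥0∞ :=
  (∫⁻ p, ‖p.1 - p.2‖ₑ ^ 2 ∂γ) ^ (1 / 2 : ℝ)

/-- The Wasserstein-2 distance (the infimum is finite on `𝒫₂`). -/
noncomputable def W2 {d : ℕ} (μ ν : Measure (Euc d)) : ℝ :=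
  (⨅ γ ∈ couplings μ ν, transportCost γ).toReal

/-- `Π_o(μ, ν)`: the couplings that attain the infimum in the Wasserstein distance. -/
def optimalPlans {d : ℕ} (μ ν : Measure (Euc d)) : Set (Measure (Euc d × Euc d)) :=
  {γ | γ ∈ couplings μ ν ∧ ∀ γ' ∈ couplings μ ν, transportCost γ ≤ transportCost γ'}

/-- The convex combination `(1 - s) ρ + s ν`, for `s ∈ [0, 1]`. -/
noncomputable def mix {d : ℕ} (ρ ν : Measure (Euc d)) (s : ℝ) : Measure (Euc d) :=
  ENNReal.ofReal (1 - s) • ρ + ENNReal.ofReal s • ν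

/-- `f` is a first variation at `ρ` of the real-valued functional `F` on `𝒫₂(C)`:
`∫ f d(ν - ρ) = d/ds F((1 - s) ρ + s ν)` at `s = 0⁺`, for all `ν ∈ 𝒫₂(C)`. -/
def IsFirstVariation {d : ℕ} (C : Set (Euc d)) (F : Measure (Euc d) → ℝ) (ρ : Measure (Euc d))
    (f : Euc d → ℝ) : Prop :=
  Integrable f ρ ∧ ∀ ν ∈ P2 C, Integrable f ν ∧
    HasDerivWithinAt (fun s : ℝ => F (mix ρ ν s)) (∫ x, f x ∂ν - ∫ x, f x ∂ρ) (Icc 0 1) 0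

/-- `ξ ∈ L²(ρ; ℝᵈ)` is a Wasserstein gradient at `ρ` of the real-valued functional `F` on `𝒫₂(C)`:
for all `ν ∈ 𝒫₂(C)` there is an optimal plan `π = plan ν` between `ρ` and `ν` with
`F[ν] = F[ρ] + ∫ ⟨ξ(x), y - x⟩ dπ(x, y) + o(W₂(ρ, ν))`. -/
def IsWassersteinGradient {d : ℕ} (C : Set (Euc d)) (F : Measure (Euc d) → ℝ)
    (ρ : Measure (Euc d)) (ξ : Euc d → Euc d) : Prop :=
  MemLp ξ 2 ρ ∧ ∃ plan : Measure (Euc d) → Measure (Euc d × Euc d),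
    (∀ ν ∈ P2 C, plan ν ∈ optimalPlans ρ ν) ∧
    ∀ η : ℝ, 0 < η → ∃ δ : ℝ, 0 < δ ∧ ∀ ν ∈ P2 C, W2 ρ ν < δ →
      |F ν - F ρ - ∫ p, inner ℝ (ξ p.1) (p.2 - p.1) ∂(plan ν)| ≤ η * W2 ρ ν

/-- `ξ` lies in the tangent space of `𝒫₂` at `ρ`: the closure in `L²(ρ; ℝᵈ)` of the gradients of
smooth compactly supported functions on `ℝᵈ`. -/
def IsTangent {d : ℕ} (ρ : Measure (Euc d)) (ξ : Euc d → Euc d) : Prop :=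
  MemLp ξ 2 ρ ∧ ∀ η : ℝ≥0∞, 0 < η → ∃ φ : Euc d → ℝ,
    ContDiff ℝ (⊤ : ℕ∞) φ ∧ HasCompactSupport φ ∧ eLpNorm (fun x => ξ x - gradient φ x) 2 ρ < η

/-- `L²(P; C)`: the elements of `L²(P; ℝᵈ)` with values in `C`. -/
def L2In {d : ℕ} {Z : Type*} [MeasurableSpace Z] (P : Measure Z) (C : Set (Euc d)) :
    Set (Lp (Euc d) 2 P) :=
  {X | ∀ᵐ z ∂P, X z ∈ C}

/-- The lift `X ↦ F[Law(X)] = F[X_# P]`. -/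
noncomputable def lift {d : ℕ} {Z : Type*} [MeasurableSpace Z] (P : Measure Z)
    (F : Measure (Euc d) → ℝ) (X : Lp (Euc d) 2 P) : ℝ :=
  F (P.map X)

/-- `F` is L-differentiable at `ρ`: the lift of `F`, a function on `L²(P; C)`, is Fréchet
differentiable at some `X` with law `ρ`. -/
def IsLDifferentiableAt {d : ℕ} {Z : Type*} [MeasurableSpace Z] (P : Measure Z) (C : Set (Euc d))
    (F : Measure (Euc d) → ℝ) (ρ : Measure (Euc d)) : Prop :=
  ∃ X ∈ L2In P C, P.map X = ρ ∧ DifferentiableWithinAt ℝ (lift P F) (L2In P C) X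

/-- `ξ` is the L-derivative of `F` at `ρ`: at every `X ∈ L²(P; C)` with law `ρ`, the lift is
Fréchet differentiable, with derivative `ξ ∘ X` (identified with an element of `L²(P; ℝᵈ)`). -/
def IsLDerivative {d : ℕ} {Z : Type*} [MeasurableSpace Z] (P : Measure Z) (C : Set (Euc d))
    (F : Measure (Euc d) → ℝ) (ρ : Measure (Euc d)) (ξ : Euc d → Euc d) : Prop :=
  MemLp ξ 2 ρ ∧ ∀ X ∈ L2In P C, P.map X = ρ →
    ∃ G : Lp (Euc d) 2 P, (∀ᵐ z ∂P, G z = ξ (X z)) ∧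
      HasGradientWithinAt (lift P F) G (L2In P C) X

/-- The Gaussian kernel `φ_ε(x) = exp(-‖x‖² / (2ε))`. -/
noncomputable def gaussKernel {d : ℕ} (ε : ℝ) (x : Euc d) : ℝ :=
  Real.exp (-(‖x‖ ^ 2 / (2 * ε)))

/-- `(φ_ε * ρ)(x)`. -/
noncomputable def gaussConv {d : ℕ} (ε : ℝ) (ρ : Measure (Euc d)) (x : Euc d) : ℝ :=
  ∫ y, gaussKernel ε (x - y) ∂ρ

/-- The regularized KL divergence `F^ε[ρ] = ∫ (U + ln (φ_ε * ρ)) dρ`, for `ρ` concentrated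
on the domain of `U`. -/
noncomputable def regKL {d : ℕ} (U : Euc d → ℝ) (ε : ℝ) (ρ : Measure (Euc d)) : ℝ :=
  ∫ x, (U x + Real.log (gaussConv ε ρ x)) ∂ρ

/-- The assumption on the potential `U : C → ℝ` (values off `C` play no role): `U` is
differentiable on `C` (relative to `C` at boundary points), `∇U` is `C₁`-Lipschitz on `C`, and
`|U(x₀)| ≤ C₀`, `‖∇U(x₀)‖ ≤ C₂` at some `x₀ ∈ C`. -/
def PotentialAssumption {d : ℕ} (C : Set (Euc d)) (U : Euc d → ℝ) (C₀ C₁ C₂ : ℝ) : Prop :=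
  ∃ gradU : Euc d → Euc d,
    (∀ x ∈ C, HasGradientWithinAt U (gradU x) C x) ∧
    (∀ x ∈ C, ∀ y ∈ C, ‖gradU x - gradU y‖ ≤ C₁ * ‖x - y‖) ∧
    ∃ x₀ ∈ C, |U x₀| ≤ C₀ ∧ ‖gradU x₀‖ ≤ C₂

end RegKL

/-! On `C` everything is smooth and quantitative. If `D` bounds the diameter of `C`, then `φ_ε * ρ ≥
exp(-D²/(2ε))` on `C`, so the logarithm stays away from its singularity and `ln (φ_ε * ρ)` has a
Lipschitz gradient there. The candidate first variation is `f = U + ln (φ_ε * ρ) + φ_ε * (ρ / (φ_ε *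
ρ))`, and `firstVar_c11On` shows that it has a Lipschitz gradient as well.

One estimate carries all the differentiability claims. By `exists_regKL_expansion`, for every
coupling `γ` of `ρ` and `ν`, optimal or not, `F[ν] - F[ρ] - ∫ f d(ν - ρ)` is at most a constant
times `(∫ |x - y| dγ)²`. A coupling of `ρ` with `(1 - s) ρ + s ν` that leaves mass `1 - s` in place
gives the first variation. Expanding `f` to first order replaces `∫ f d(ν - ρ)` by `∫ ⟨∇f(x), y - x⟩
dγ` with error `O(∫ |x - y|² dγ)` (`abs_sub_integral_inner_le`). Optimal plans then give the
Wasserstein gradient, and joint laws of `(X, Y)` give the L-derivative.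

Testing with Dirac masses shows that first variations agree on `C` up to a constant. L-derivatives
are unique because `C` has an interior point around which every direction is admissible. The field
`∇f` is tangent because contracting `C` towards an interior point leaves room to mollify `f`
(`C11On.exists_contDiff_gradient_approx`).

Uniqueness of the tangent Wasserstein gradient is subtler, since two gradients may come with
different optimal plans. It is tested along `x ↦ x + s v(x)` with `v = (x₀ - x) + t ∇φ`, which
points into `C`. For small `s` a dual potential shows that the optimal plan is unique
(`eq_map_of_mem_optimalPlans`). Subtracting the case `t = 0` leaves the test against `∇φ`, and such
gradients are dense in the tangent space. -/

namespace RegKL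
open ProbabilityTheory

/-! ### Laws of random variables on atomless spaces -/

/-- The distribution function of an atomless probability measure is continuous. -/
lemma continuous_cdf_of_nullSingleton (μ : Measure ℝ) [IsProbabilityMeasure μ]
    [NullSingletonClass μ] : Continuous (cdf μ) := by
  rw [continuous_iff_continuousAt]
  intro x
  -- The jump of the distribution function at `x` is the mass of `{x}`, which vanishes.
  have h1 : Function.leftLim (cdf μ) x = cdf μ x := by
    have h := (cdf μ).measure_singleton x
    rw [measure_cdf, measure_singleton] at h
    have h2 := ENNReal.ofReal_eq_zero.1 h.symm
    exact le_antisymm ((cdf μ).mono.leftLim_le le_rfl) (by linarith)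
  rw [continuousAt_iff_continuous_left'_right']
  refine ⟨?_, ((cdf μ).right_continuous x).mono Ioi_subset_Ici_self⟩
  have := (cdf μ).mono.tendsto_leftLim x
  rwa [h1] at this

/-- The distribution function of an atomless law is uniformly distributed under that law. -/
lemma measure_cdf_le (μ : Measure ℝ) [IsProbabilityMeasure μ] [NullSingletonClass μ] {t : ℝ}
    (ht0 : 0 ≤ t) (ht1 : t ≤ 1) : μ {x | cdf μ x ≤ t} = ENNReal.ofReal t := by
  have hc := continuous_cdf_of_nullSingleton μ
  have hivt : ∀ r, 0 < r → r < 1 → ∃ x, cdf μ x = r := fun r h0 h1 =>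
    mem_range_of_exists_le_of_exists_ge hc
      ((tendsto_cdf_atBot μ).eventually (eventually_le_nhds h0)).exists
      ((tendsto_cdf_atTop μ).eventually (eventually_ge_nhds h1)).exists
  rcases ht1.eq_or_lt with rfl | ht1
  · have : {x | cdf μ x ≤ 1} = univ := eq_univ_of_forall fun x => cdf_le_one μ x
    rw [this]; simp
  apply le_antisymm
  -- The level `r > t` is attained at some `x`, and the sublevel set at `t` lies in `Iic x`, of mass
  -- `r`; then `r ↓ t`.
  · have : ∀ r, t < r → r < 1 → μ {x | cdf μ x ≤ t} ≤ ENNReal.ofReal r := by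
      intro r h1 h2
      obtain ⟨x, hx⟩ := hivt r (by linarith) h2
      rw [← hx, ofReal_cdf]
      refine measure_mono fun y (hy : cdf μ y ≤ t) => ?_
      by_contra hyx
      have := monotone_cdf μ (le_of_lt (not_le.1 hyx))
      linarith
    have hlim : Tendsto (fun r => ENNReal.ofReal r) (𝓝[>] t) (𝓝 (ENNReal.ofReal t)) :=
      (ENNReal.continuous_ofReal.tendsto t).mono_left nhdsWithin_le_nhds
    refine ge_of_tendsto hlim ?_
    filter_upwards [Ioo_mem_nhdsGT ht1] with r hr using this r hr.1 hr.2
  · rcases ht0.eq_or_lt with rfl | ht0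
    · simp
    obtain ⟨x, hx⟩ := hivt t ht0 ht1
    rw [← hx, ofReal_cdf]
    exact measure_mono fun y hy => monotone_cdf μ hy

/-- An atomless probability measure on a Polish space can be mapped onto any law. -/
lemma exists_measurable_map_eq_of_nullSingleton {Z Y : Type*} [MeasurableSpace Z]
    [StandardBorelSpace Z] [MeasurableSpace Y] [StandardBorelSpace Y] [Nonempty Y]
    (P : Measure Z) [IsProbabilityMeasure P] [NullSingletonClass P]
    (ρ : Measure Y) [IsProbabilityMeasure ρ] : ∃ X : Z → Y, Measurable X ∧ P.map X = ρ := by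
  obtain ⟨q, hq, hqρ⟩ := Measure.exists_measurable_map_eq ρ
  have he := measurableEmbedding_embeddingReal Z
  set μ := P.map (embeddingReal Z) with hμ
  have : IsProbabilityMeasure μ := Measure.isProbabilityMeasure_map he.measurable.aemeasurable
  have : NullSingletonClass μ := ⟨fun x => by
    rw [hμ, Measure.map_apply he.measurable (measurableSet_singleton x)]
    exact (subsingleton_singleton.preimage he.injective).measure_zero P⟩
  let u : Z → unitInterval := fun z =>
    ⟨cdf μ (embeddingReal Z z), cdf_nonneg μ _, cdf_le_one μ _⟩
  have hu : Measurable u := Measurable.subtype_mk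
    ((monotone_cdf μ).measurable.comp he.measurable)
  have huP : P.map u = volume := by
    have : IsProbabilityMeasure (P.map u) := Measure.isProbabilityMeasure_map hu.aemeasurable
    refine Measure.ext_of_Iic _ _ fun t => ?_
    rw [Measure.map_apply hu measurableSet_Iic, unitInterval.volume_Iic,
      ← measure_cdf_le μ t.2.1 t.2.2, hμ, he.map_apply]
    rfl
  refine ⟨q ∘ u, hq.comp hu, ?_⟩
  rw [← Measure.map_map hq hu, huP, hqρ]

/-- If a random variable on a Polish space almost surely takes values in a set, its law is
concentrated on that set, even when the set is not Borel. -/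
lemma map_compl_eq_zero_of_ae_mem {Z Y : Type*} [tZ : TopologicalSpace Z] [PolishSpace Z]
    [MeasurableSpace Z] [BorelSpace Z] [TopologicalSpace Y] [T2Space Y]
    [SecondCountableTopology Y] [MeasurableSpace Y] [BorelSpace Y]
    (P : Measure Z) [IsFiniteMeasure P] {X : Z → Y}
    (hX : Measurable X) {C : Set Y} (hC : ∀ᵐ z ∂P, X z ∈ C) : P.map X Cᶜ = 0 := by
  have hZ := BorelSpace.measurable_eq (α := Z)
  -- A finer Polish topology with the same Borel sets makes `X` continuous. Inner regularity in that
  -- topology gives a compact `K` of nearly full mass with `X '' K ⊆ C`. The image is compact, hence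
  -- Borel, whatever `C` is.
  obtain ⟨t', ht', hcont, hpol⟩ := hX.exists_continuous
  have hborel : @BorelSpace Z t' _ := by
    refine @BorelSpace.mk Z t' _ ?_
    exact hZ.trans (borel_eq_borel_of_le hpol ‹_› ht').symm
  obtain ⟨N, hNsub, hNm, hN0⟩ := exists_measurable_superset_of_null (ae_iff.1 hC)
  have hNC : ∀ z ∈ Nᶜ, X z ∈ C := fun z hz => by
    by_contra h
    exact hz (hNsub h)
  refine le_antisymm (ENNReal.le_of_forall_pos_le_add fun η hη _ => ?_) zero_le
  let _ := t'
  obtain ⟨K, hKN, hK, hKlt⟩ := hNm.compl.exists_isCompact_lt_add (μ := P) (measure_ne_top P _)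
    (ε := (η : ℝ≥0∞)) (by positivity)
  have hXK : IsCompact (X '' K) := hK.image hcont
  have hsub : Cᶜ ⊆ (X '' K)ᶜ := compl_subset_compl.2 (by
    rintro _ ⟨z, hz, rfl⟩
    exact hNC z (hKN hz))
  calc P.map X Cᶜ ≤ P.map X (X '' K)ᶜ := measure_mono hsub
    _ = P (X ⁻¹' (X '' K)ᶜ) := Measure.map_apply hX hXK.measurableSet.compl
    _ ≤ P Kᶜ := measure_mono (compl_subset_compl.2 (subset_preimage_image X K))
    _ ≤ P N + P (Nᶜ \ K) := by
        refine (measure_mono (t := N ∪ (Nᶜ \ K)) fun z hz => ?_).trans (measure_union_le _ _)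
        by_cases h : z ∈ N
        · exact Or.inl h
        · exact Or.inr ⟨h, hz⟩
    _ ≤ 0 + η := by
        rw [hN0]
        gcongr
        rw [measure_sdiff hKN hK.measurableSet.nullMeasurableSet (measure_ne_top P _)]
        exact tsub_le_iff_left.2 hKlt.le


/-! ### Couplings and optimal plans -/

lemma integrable_of_continuous_of_ae_norm_le {E F : Type*} [NormedAddCommGroup E] [ProperSpace E]
    [MeasurableSpace E] [BorelSpace E] [NormedAddCommGroup F] [SecondCountableTopology E]
    {μ : Measure E} [IsFiniteMeasure μ] {R : ℝ} (hR : ∀ᵐ x ∂μ, ‖x‖ ≤ R) {g : E → F}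
    (hg : Continuous g) : Integrable g μ := by
  obtain ⟨B, hB⟩ := (isCompact_closedBall (0 : E) R).exists_bound_of_continuousOn hg.continuousOn
  refine Integrable.of_bound hg.aestronglyMeasurable B ?_
  filter_upwards [hR] with x hx using hB x (by simpa using hx)

lemma ae_prod_of_mem_couplings {d : ℕ} {μ ν : Measure (Euc d)} {γ : Measure (Euc d × Euc d)}
    (hγ : γ ∈ couplings μ ν) {p q : Euc d → Prop} (hp : ∀ᵐ x ∂μ, p x) (hq : ∀ᵐ x ∂ν, q x) :
    ∀ᵐ z ∂γ, p z.1 ∧ q z.2 := by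
  rw [← hγ.1] at hp
  rw [← hγ.2] at hq
  filter_upwards [ae_of_ae_map measurable_fst.aemeasurable hp,
    ae_of_ae_map measurable_snd.aemeasurable hq] with z h1 h2 using ⟨h1, h2⟩

lemma isProbabilityMeasure_of_mem_couplings {d : ℕ} {μ ν : Measure (Euc d)}
    [IsProbabilityMeasure μ] {γ : Measure (Euc d × Euc d)} (hγ : γ ∈ couplings μ ν) :
    IsProbabilityMeasure γ := by
  have : IsProbabilityMeasure (γ.map Prod.fst) := by rw [hγ.1]; infer_instance
  exact Measure.isProbabilityMeasure_of_map Prod.fst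

lemma prod_mem_couplings {d : ℕ} (μ ν : Measure (Euc d)) [IsProbabilityMeasure μ]
    [IsProbabilityMeasure ν] : μ.prod ν ∈ couplings μ ν :=
  ⟨by simp, by simp⟩

lemma map_prodMk_mem_couplings {d : ℕ} {Z : Type*} [MeasurableSpace Z] (P : Measure Z)
    {X Y : Z → Euc d} (hX : Measurable X) (hY : Measurable Y) :
    P.map (fun z => (X z, Y z)) ∈ couplings (P.map X) (P.map Y) := by
  constructor
  · rw [Measure.map_map measurable_fst (hX.prodMk hY)]; rfl
  · rw [Measure.map_map measurable_snd (hX.prodMk hY)]; rfl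

lemma transportCost_le_iff {d : ℕ} {γ γ' : Measure (Euc d × Euc d)} :
    transportCost γ ≤ transportCost γ' ↔
      ∫⁻ p, ‖p.1 - p.2‖ₑ ^ 2 ∂γ ≤ ∫⁻ p, ‖p.1 - p.2‖ₑ ^ 2 ∂γ' := by
  unfold transportCost
  exact ENNReal.rpow_le_rpow_iff (by norm_num)

lemma toReal_transportCost_sq {d : ℕ} (γ : Measure (Euc d × Euc d)) :
    (transportCost γ).toReal ^ 2 = ∫ p, ‖p.1 - p.2‖ ^ 2 ∂γ := by
  rw [integral_eq_lintegral_of_nonneg_ae (ae_of_all _ fun p => by positivity)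
    (by fun_prop), transportCost, ← ENNReal.toReal_rpow, ← Real.sqrt_eq_rpow,
    Real.sq_sqrt ENNReal.toReal_nonneg]
  congr 1
  refine lintegral_congr fun p => ?_
  rw [ENNReal.ofReal_pow (norm_nonneg _), ofReal_norm]

lemma W2_eq_of_mem_optimalPlans {d : ℕ} {μ ν : Measure (Euc d)} {γ : Measure (Euc d × Euc d)}
    (hγ : γ ∈ optimalPlans μ ν) : W2 μ ν = (transportCost γ).toReal := by
  unfold W2
  congr 1
  exact le_antisymm (iInf₂_le γ hγ.1) (le_iInf₂ hγ.2)

lemma W2_sq_of_mem_optimalPlans {d : ℕ} {μ ν : Measure (Euc d)} {γ : Measure (Euc d × Euc d)}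
    (hγ : γ ∈ optimalPlans μ ν) : W2 μ ν ^ 2 = ∫ p, ‖p.1 - p.2‖ ^ 2 ∂γ := by
  rw [W2_eq_of_mem_optimalPlans hγ, toReal_transportCost_sq]

/-- Optimal plans between probability measures with bounded support exist. -/
lemma optimalPlans_nonempty {d : ℕ} {μ ν : Measure (Euc d)} [IsProbabilityMeasure μ]
    [IsProbabilityMeasure ν] {R : ℝ} (hμ : ∀ᵐ x ∂μ, ‖x‖ ≤ R) (hν : ∀ᵐ x ∂ν, ‖x‖ ≤ R) :
    (optimalPlans μ ν).Nonempty := by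
  let S : Set (ProbabilityMeasure (Euc d × Euc d)) :=
    {γ | γ.map measurable_fst.aemeasurable = (⟨μ, ‹_›⟩ : ProbabilityMeasure (Euc d)) ∧
      γ.map measurable_snd.aemeasurable = (⟨ν, ‹_›⟩ : ProbabilityMeasure (Euc d))}
  have hSc : ∀ γ : ProbabilityMeasure (Euc d × Euc d),
      γ ∈ S ↔ (γ : Measure (Euc d × Euc d)) ∈ couplings μ ν := fun γ =>
    and_congr (Subtype.ext_iff) (Subtype.ext_iff)
  have hSclosed : IsClosed S := by
    refine IsClosed.inter ?_ ?_
    · exact isClosed_eq (ProbabilityMeasure.continuous_map continuous_fst) continuous_const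
    · exact isClosed_eq (ProbabilityMeasure.continuous_map continuous_snd) continuous_const
  have hbd : ∀ γ ∈ couplings μ ν, ∀ᵐ p ∂γ, ‖p.1‖ ≤ R ∧ ‖p.2‖ ≤ R := fun γ hγ =>
    ae_prod_of_mem_couplings hγ hμ hν
  -- Prokhorov: all couplings live on one compact ball, so they form a tight family.
  have hScompact : IsCompact S := by
    rw [← hSclosed.closure_eq]
    refine isCompact_closure_of_isTightMeasureSet ?_
    rw [isTightMeasureSet_iff_exists_isCompact_measure_compl_le]
    refine fun η hη => ⟨Metric.closedBall 0 R, isCompact_closedBall _ _, ?_⟩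
    rintro _ ⟨γ, hγ, rfl⟩
    have : (γ : Measure (Euc d × Euc d)) (Metric.closedBall 0 R)ᶜ = 0 := by
      rw [← mem_ae_iff]
      filter_upwards [hbd _ ((hSc γ).1 hγ)] with p hp
      simpa [Prod.norm_def] using hp
    rw [this]; exact zero_le
  have hSne : S.Nonempty := ⟨⟨μ.prod ν, inferInstance⟩, (hSc _).2 (prod_mem_couplings μ ν)⟩
  -- Truncating the cost at `(2R)²` changes nothing on the support of any coupling, and makes the
  -- cost weakly continuous in the coupling.
  let g : BoundedContinuousFunction (Euc d × Euc d) NNReal :=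
    BoundedContinuousFunction.mkOfBound
      ⟨fun p => min (‖p.1 - p.2‖₊ ^ 2) (Real.toNNReal ((2 * R) ^ 2)), by fun_prop⟩
      (Real.toNNReal ((2 * R) ^ 2)) (by
        intro p q
        rw [NNReal.dist_eq, abs_le]
        have h1 : ((min (‖p.1 - p.2‖₊ ^ 2) (Real.toNNReal ((2 * R) ^ 2)) : NNReal) : ℝ) ≤
          Real.toNNReal ((2 * R) ^ 2) := NNReal.coe_le_coe.2 (min_le_right _ _)
        have h2 : ((min (‖q.1 - q.2‖₊ ^ 2) (Real.toNNReal ((2 * R) ^ 2)) : NNReal) : ℝ) ≤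
          Real.toNNReal ((2 * R) ^ 2) := NNReal.coe_le_coe.2 (min_le_right _ _)
        have h3 := (min (‖p.1 - p.2‖₊ ^ 2) (Real.toNNReal ((2 * R) ^ 2))).2
        have h4 := (min (‖q.1 - q.2‖₊ ^ 2) (Real.toNNReal ((2 * R) ^ 2))).2
        change -_ ≤ ((min (‖p.1 - p.2‖₊ ^ 2) _ : NNReal) : ℝ) - (min (‖q.1 - q.2‖₊ ^ 2) _ : NNReal) ∧
          ((min (‖p.1 - p.2‖₊ ^ 2) _ : NNReal) : ℝ) - (min (‖q.1 - q.2‖₊ ^ 2) _ : NNReal) ≤ _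
        constructor <;> linarith)
  have hcost : ∀ γ ∈ couplings μ ν, ∫⁻ p, g p ∂γ = ∫⁻ p, ‖p.1 - p.2‖ₑ ^ 2 ∂γ := by
    intro γ hγ
    refine lintegral_congr_ae ?_
    filter_upwards [hbd γ hγ] with p hp
    have h : ‖p.1 - p.2‖₊ ^ 2 ≤ Real.toNNReal ((2 * R) ^ 2) := by
      rw [← NNReal.coe_le_coe, Real.coe_toNNReal _ (by positivity)]
      push_cast
      have := norm_sub_le p.1 p.2
      gcongr
      linarith [hp.1, hp.2]
    have h2 : g p = ‖p.1 - p.2‖₊ ^ 2 := min_eq_left h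
    rw [h2]
    simp [enorm_eq_nnnorm]
  obtain ⟨γ, hγ, hmin⟩ := hScompact.exists_isMinOn hSne
    (ProbabilityMeasure.continuous_lintegral_boundedContinuousFunction g).continuousOn
  refine ⟨γ, (hSc γ).1 hγ, fun γ' hγ' => ?_⟩
  have := isProbabilityMeasure_of_mem_couplings hγ'
  have h := hmin ((hSc ⟨γ', this⟩).2 hγ')
  rw [transportCost_le_iff, ← hcost _ hγ', ← hcost _ ((hSc γ).1 hγ)]
  exact h

/-- If `T` moves every point optimally, in a uniformly strict sense, for a dual potential `q`,
then the plan induced by `T` is the only optimal one. -/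
lemma eq_map_of_mem_optimalPlans {d : ℕ} {ρ : Measure (Euc d)} [IsProbabilityMeasure ρ] {R : ℝ}
    (hρ : ∀ᵐ x ∂ρ, ‖x‖ ≤ R) {T : Euc d → Euc d} (hT : Continuous T) {q : Euc d → ℝ}
    (hq : Continuous q) {c : ℝ} (hc : 0 < c)
    (hTq : ∀ x y, c * ‖x - y‖ ^ 2 ≤ ‖x - T y‖ ^ 2 - ‖y - T y‖ ^ 2 + q x - q y)
    {γ : Measure (Euc d × Euc d)} (hγ : γ ∈ optimalPlans ρ (ρ.map T)) :
    γ = ρ.map (fun x => (x, T x)) := by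
  -- If `T x = T y`, adding `hTq x y` and `hTq y x` cancels the right-hand sides.
  have hinj : Function.Injective T := by
    intro x y hxy
    have h1 := hTq x y
    have h2 := hTq y x
    rw [hxy] at h2
    rw [norm_sub_rev y x] at h2
    have h3 : c * ‖x - y‖ ^ 2 ≤ 0 := by linarith
    have h4 : ‖x - y‖ ^ 2 ≤ 0 := by
      by_contra h
      have := mul_pos hc (not_le.1 h)
      linarith
    have : ‖x - y‖ = 0 := by nlinarith [norm_nonneg (x - y)]
    exact sub_eq_zero.1 (norm_eq_zero.1 this)
  -- `S` is a Borel left inverse of `T`, so the goal becomes `p.1 = S p.2` for `γ`-almost every `p`.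
  obtain ⟨S, hS, hST⟩ := (hT.measurableEmbedding hinj).exists_measurable_extend measurable_id
    (fun _ => inferInstance)
  replace hST : ∀ x, S (T x) = x := fun x => congrFun hST x
  have hγp := isProbabilityMeasure_of_mem_couplings hγ.1
  obtain ⟨R', hR'⟩ := (isCompact_closedBall (0 : Euc d) R).exists_bound_of_continuousOn
    hT.continuousOn
  have hTS : ∀ᵐ y ∂(ρ.map T), T (S y) = y ∧ ‖S y‖ ≤ R ∧ ‖y‖ ≤ R' := by
    rw [ae_map_iff hT.aemeasurable]
    · filter_upwards [hρ] with x hx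
      rw [hST]
      exact ⟨rfl, hx, hR' x (by simpa using hx)⟩
    · exact (measurableSet_eq_fun (hT.measurable.comp hS) measurable_id).inter
        ((measurableSet_le hS.norm measurable_const).inter
          (measurableSet_le measurable_norm measurable_const))
  have hae := ae_prod_of_mem_couplings hγ.1 hρ hTS
  have hbd : ∀ᵐ p ∂γ, ‖p‖ ≤ max R R' := by
    filter_upwards [hae] with p hp
    rw [Prod.norm_def]
    exact max_le_max hp.1 hp.2.2.2
  have hm1 : MeasurePreserving Prod.fst γ ρ := ⟨measurable_fst, hγ.1.1⟩
  have hm2 : MeasurePreserving (fun p : Euc d × Euc d => S p.2) γ ρ := by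
    refine ⟨hS.comp measurable_snd, ?_⟩
    change γ.map (S ∘ Prod.snd) = ρ
    rw [← Measure.map_map hS measurable_snd, hγ.1.2, Measure.map_map hS hT.measurable]
    have : S ∘ T = id := funext hST
    rw [this, Measure.map_id]
  -- This image depends only on the second marginal of `γ`. Hence the cost of the plan induced by
  -- `T` can be computed under `γ` and compared pointwise.
  have hm3 : MeasurePreserving (fun p : Euc d × Euc d => (S p.2, p.2)) γ
      (ρ.map (fun x => (x, T x))) := by
    refine ⟨(hS.comp measurable_snd).prodMk measurable_snd, ?_⟩
    have hm : Measurable fun y => (S y, y) := hS.prodMk measurable_id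
    change γ.map ((fun y => (S y, y)) ∘ Prod.snd) = _
    rw [← Measure.map_map hm measurable_snd, hγ.1.2, Measure.map_map hm hT.measurable]
    congr 1
    funext x
    simp [hST]
  have hm4 : Measurable (fun p : Euc d × Euc d => (p.1, S p.2)) :=
    measurable_fst.prodMk (hS.comp measurable_snd)
  have hI0 : Integrable q ρ := integrable_of_continuous_of_ae_norm_le hρ hq
  have hcontsq : Continuous fun p : Euc d × Euc d => ‖p.1 - p.2‖ ^ 2 := by fun_prop
  have hTcoup : ρ.map (fun x => (x, T x)) ∈ couplings ρ (ρ.map T) := by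
    have := map_prodMk_mem_couplings ρ measurable_id hT.measurable
    rwa [Measure.map_id] at this
  have hI1 : Integrable (fun p : Euc d × Euc d => ‖p.1 - p.2‖ ^ 2) γ :=
    integrable_of_continuous_of_ae_norm_le hbd hcontsq
  have hI2' : Integrable (fun p : Euc d × Euc d => ‖p.1 - p.2‖ ^ 2)
      (ρ.map (fun x => (x, T x))) := by
    rw [integrable_map_measure hcontsq.aestronglyMeasurable (by fun_prop)]
    exact integrable_of_continuous_of_ae_norm_le hρ (by fun_prop)
  have hI2 : Integrable (fun p : Euc d × Euc d => ‖S p.2 - p.2‖ ^ 2) γ :=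
    hm3.integrable_comp_of_integrable hI2'
  have hI3 : Integrable (fun p : Euc d × Euc d => ‖p.1 - S p.2‖ ^ 2) γ := by
    have : Integrable (fun p : Euc d × Euc d => ‖p.1 - p.2‖ ^ 2)
        (γ.map (fun p => (p.1, S p.2))) := by
      have := Measure.isProbabilityMeasure_map (μ := γ) hm4.aemeasurable
      refine integrable_of_continuous_of_ae_norm_le (R := R) ?_ hcontsq
      rw [ae_map_iff hm4.aemeasurable (measurableSet_le measurable_norm measurable_const)]
      filter_upwards [hae] with p hp
      rw [Prod.norm_def]
      exact max_le hp.1 hp.2.2.1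
    exact this.comp_measurable hm4
  have hIq1 : Integrable (fun p : Euc d × Euc d => q p.1) γ := hm1.integrable_comp_of_integrable hI0
  have hIq2 : Integrable (fun p : Euc d × Euc d => q (S p.2)) γ :=
    hm2.integrable_comp_of_integrable hI0
  -- Both `p.1` and `S p.2` have law `ρ` under `γ`, so the dual potential drops out on integrating
  -- `hTq p.1 (S p.2)`.
  have hq12 : ∫ p, q p.1 ∂γ = ∫ p, q (S p.2) ∂γ := by
    have h1 : ∫ p, q p.1 ∂γ = ∫ x, q x ∂ρ := by
      rw [← hm1.map_eq]
      exact (integral_map measurable_fst.aemeasurable hq.aestronglyMeasurable).symm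
    have h2 : ∫ p, q (S p.2) ∂γ = ∫ x, q x ∂ρ := by
      rw [← hm2.map_eq]
      exact (integral_map hm2.measurable.aemeasurable hq.aestronglyMeasurable).symm
    rw [h1, h2]
  have hle : ∫ p, ‖p.1 - p.2‖ ^ 2 ∂γ ≤ ∫ p, ‖S p.2 - p.2‖ ^ 2 ∂γ := by
    have h1 : ∫ p, ‖S p.2 - p.2‖ ^ 2 ∂γ = ∫ p, ‖p.1 - p.2‖ ^ 2 ∂(ρ.map (fun x => (x, T x))) := by
      rw [← hm3.map_eq]
      exact (integral_map hm3.measurable.aemeasurable hcontsq.aestronglyMeasurable).symm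
    have h2 := hγ.2 _ hTcoup
    rw [h1, ← toReal_transportCost_sq, ← toReal_transportCost_sq]
    have hfin : transportCost (ρ.map (fun x => (x, T x))) ≠ ∞ := by
      refine ENNReal.rpow_ne_top_of_nonneg (by norm_num) ?_
      have := hI2'.lintegral_lt_top
      refine ne_of_lt (lt_of_eq_of_lt (lintegral_congr fun p => ?_) this)
      rw [ENNReal.ofReal_pow (norm_nonneg _), ofReal_norm]
    gcongr
  have hI4 : Integrable (fun p : Euc d × Euc d => ‖p.1 - p.2‖ ^ 2 - ‖S p.2 - p.2‖ ^ 2) γ :=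
    hI1.sub hI2
  have hI5 : Integrable (fun p : Euc d × Euc d => q p.1 - q (S p.2)) γ := hIq1.sub hIq2
  have hint : ∫ p, c * ‖p.1 - S p.2‖ ^ 2 ∂γ ≤ 0 := by
    calc ∫ p, c * ‖p.1 - S p.2‖ ^ 2 ∂γ
        ≤ ∫ p, ((‖p.1 - p.2‖ ^ 2 - ‖S p.2 - p.2‖ ^ 2) + (q p.1 - q (S p.2))) ∂γ := by
          refine integral_mono_ae (hI3.const_mul c) (hI4.add hI5) ?_
          filter_upwards [hae] with p hp
          have := hTq p.1 (S p.2)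
          rw [hp.2.1] at this
          linarith
      _ = (∫ p, ‖p.1 - p.2‖ ^ 2 ∂γ - ∫ p, ‖S p.2 - p.2‖ ^ 2 ∂γ) +
          (∫ p, q p.1 ∂γ - ∫ p, q (S p.2) ∂γ) := by
          rw [integral_add hI4 hI5, integral_sub hI1 hI2,
            integral_sub hIq1 hIq2]
      _ ≤ 0 := by rw [hq12]; linarith
  have hzero : ∀ᵐ p ∂γ, p.1 = S p.2 := by
    have h0 : ∫ p, c * ‖p.1 - S p.2‖ ^ 2 ∂γ = 0 :=
      le_antisymm hint (integral_nonneg fun p => by positivity)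
    rw [integral_eq_zero_iff_of_nonneg (fun p => by positivity) (hI3.const_mul c)] at h0
    filter_upwards [h0] with p hp
    simp only [Pi.zero_apply, mul_eq_zero, hc.ne', false_or] at hp
    exact sub_eq_zero.1 (norm_eq_zero.1 (pow_eq_zero_iff (two_ne_zero) |>.1 hp))
  have heq : (fun p : Euc d × Euc d => (S p.2, p.2)) =ᵐ[γ] id := by
    filter_upwards [hzero] with p hp
    exact Prod.ext hp.symm rfl
  rw [← hm3.map_eq, Measure.map_congr heq, Measure.map_id]


/-! ### Functions with Lipschitz gradient on a convex set -/

/-- A quadratic remainder is `o(‖y - x‖)`. The general Hilbert space allows one lemma to serve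
functions on `C`, curves of mixtures on `[0, 1]`, and the lift on `L²(P; ℝᵈ)`. -/
lemma hasGradientWithinAt_of_quadratic {F : Type*} [NormedAddCommGroup F] [InnerProductSpace ℝ F]
    [CompleteSpace F] {g : F → ℝ} {v x : F} {s : Set F} {L : ℝ} (hx : x ∈ s)
    (h : ∀ y ∈ s, |g y - g x - inner ℝ v (y - x)| ≤ L * ‖y - x‖ ^ 2) :
    HasGradientWithinAt g v s x := by
  rw [hasGradientWithinAt_iff_hasFDerivWithinAt]
  have h0 : HasFDerivWithinAt (fun y => g y - g x - inner ℝ v (y - x)) (0 : F →L[ℝ] ℝ) s x := by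
    refine Asymptotics.IsBigO.hasFDerivWithinAt (n := 2) ?_ hx one_lt_two
    refine Asymptotics.IsBigO.of_bound L ?_
    filter_upwards [self_mem_nhdsWithin] with y hy
    simpa using h y hy
  have h1 : HasFDerivWithinAt (fun y => inner ℝ v (y - x))
      (InnerProductSpace.toDual ℝ F v) s x := by
    have := (InnerProductSpace.toDual ℝ F v).hasFDerivWithinAt (s := s) (x := x)
    refine (this.sub_const (inner ℝ v x)).congr (fun y _ => ?_) ?_ <;> simp [inner_sub_right]
  have h2 := (h0.add h1).add_const (g x)
  rw [zero_add] at h2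
  refine h2.congr (fun y _ => ?_) ?_ <;> simp

/-- `g` is differentiable on `C` (relative to `C`) with `L`-Lipschitz gradient `g'`. -/
structure C11On {d : ℕ} (C : Set (Euc d)) (g : Euc d → ℝ) (g' : Euc d → Euc d) (L : ℝ) :
    Prop where
  nonneg : 0 ≤ L
  hasGradient : ∀ x ∈ C, HasGradientWithinAt g (g' x) C x
  lip : ∀ x ∈ C, ∀ y ∈ C, ‖g' x - g' y‖ ≤ L * ‖x - y‖

namespace C11On

variable {d : ℕ} {C : Set (Euc d)} {g h : Euc d → ℝ} {g' h' : Euc d → Euc d} {L M : ℝ}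

/-- Mean value inequality on the segment, where the gradient stays within `L * ‖y - x‖` of `g' x`.
The sharp constant `L / 2` is not needed. -/
lemma quadratic (hg : C11On C g g' L) (hC : Convex ℝ C) {x y : Euc d} (hx : x ∈ C) (hy : y ∈ C) :
    |g y - g x - inner ℝ (g' x) (y - x)| ≤ L * ‖y - x‖ ^ 2 := by
  have hsub : segment ℝ x y ⊆ C := hC.segment_subset hx hy
  have := (convex_segment x y).norm_image_sub_le_of_norm_hasFDerivWithin_le' (𝕜 := ℝ) (f := g)
    (f' := fun z => InnerProductSpace.toDual ℝ (Euc d) (g' z))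
    (φ := InnerProductSpace.toDual ℝ (Euc d) (g' x)) (C := L * ‖y - x‖)
    (fun z hz => ((hg.hasGradient z (hsub hz)).hasFDerivWithinAt).mono hsub)
    (fun z hz => by
      rw [← map_sub, LinearIsometryEquiv.norm_map]
      refine (hg.lip z (hsub hz) x hx).trans ?_
      gcongr
      · exact hg.nonneg
      · obtain ⟨t, ⟨h0, h1⟩, rfl⟩ := (segment_eq_image' ℝ x y ▸ hz :)
        rw [add_sub_cancel_left, norm_smul, Real.norm_eq_abs, abs_of_nonneg h0]
        exact mul_le_of_le_one_left (norm_nonneg _) h1)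
    (left_mem_segment ℝ x y) (right_mem_segment ℝ x y)
  simpa [pow_two, mul_assoc] using this

lemma of_quadratic (hL : 0 ≤ L)
    (hq : ∀ x ∈ C, ∀ y ∈ C, |g y - g x - inner ℝ (g' x) (y - x)| ≤ L * ‖y - x‖ ^ 2)
    (hl : ∀ x ∈ C, ∀ y ∈ C, ‖g' x - g' y‖ ≤ L * ‖x - y‖) : C11On C g g' L :=
  ⟨hL, fun x hx => hasGradientWithinAt_of_quadratic hx (hq x hx), hl⟩

lemma lipschitz {B : ℝ} (hC : Convex ℝ C) (hg : ∀ x ∈ C, HasGradientWithinAt g (g' x) C x)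
    (hB : ∀ x ∈ C, ‖g' x‖ ≤ B)
    {x y : Euc d} (hx : x ∈ C) (hy : y ∈ C) : |g y - g x| ≤ B * ‖y - x‖ :=
  hC.norm_image_sub_le_of_norm_hasFDerivWithin_le (𝕜 := ℝ) (f := g)
    (fun z hz => (hg z hz).hasFDerivWithinAt)
    (fun z hz => by rw [LinearIsometryEquiv.norm_map]; exact hB z hz) hx hy

lemma exists_norm_le (hg : C11On C g g' L) (hC : Bornology.IsBounded C) :
    ∃ B, 0 ≤ B ∧ ∀ x ∈ C, ‖g' x‖ ≤ B := by
  rcases C.eq_empty_or_nonempty with rfl | ⟨x₀, hx₀⟩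
  · exact ⟨0, le_rfl, by simp⟩
  obtain ⟨D, hD⟩ := Metric.isBounded_iff.1 hC
  have hD0 : 0 ≤ D := dist_nonneg.trans (hD hx₀ hx₀)
  refine ⟨‖g' x₀‖ + L * D, add_nonneg (norm_nonneg _) (mul_nonneg hg.nonneg hD0),
    fun x hx => ?_⟩
  have h1 := hg.lip x hx x₀ hx₀
  have h2 : L * ‖x - x₀‖ ≤ L * D := mul_le_mul_of_nonneg_left
    (by rw [← dist_eq_norm]; exact hD hx hx₀) hg.nonneg
  have h3 := norm_add_le (g' x₀) (g' x - g' x₀)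
  rw [add_sub_cancel] at h3
  linarith

lemma continuousOn (hg : C11On C g g' L) : ContinuousOn g C := fun x hx =>
  (hg.hasGradient x hx).hasFDerivWithinAt.continuousWithinAt

lemma continuousOn_grad (hg : C11On C g g' L) : ContinuousOn g' C := by
  refine LipschitzOnWith.continuousOn (K := ⟨L, hg.nonneg⟩)
    (LipschitzOnWith.of_dist_le_mul fun x hx y hy => ?_)
  rw [dist_eq_norm, dist_eq_norm]
  exact hg.lip x hx y hy

lemma add (hg : C11On C g g' L) (hh : C11On C h h' M) :
    C11On C (fun x => g x + h x) (fun x => g' x + h' x) (L + M) where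
  nonneg := add_nonneg hg.nonneg hh.nonneg
  hasGradient x hx := by
    have := (hg.hasGradient x hx).hasFDerivWithinAt.add (hh.hasGradient x hx).hasFDerivWithinAt
    rw [← map_add] at this
    exact this
  lip x hx y hy := by
    rw [add_sub_add_comm, add_mul]
    exact (norm_add_le _ _).trans (add_le_add (hg.lip x hx y hy) (hh.lip x hx y hy))

end C11On

lemma hasGradientWithinAt_log {d : ℕ} {C : Set (Euc d)} {g : Euc d → ℝ} {v x : Euc d}
    (hg : HasGradientWithinAt g v C x) (hx : g x ≠ 0) :
    HasGradientWithinAt (fun y => Real.log (g y)) ((g x)⁻¹ • v) C x := by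
  have := hg.hasFDerivWithinAt.log hx
  rw [hasGradientWithinAt_iff_hasFDerivWithinAt]
  simpa using this

/-- Quotient rule for `g' / g`: a lower bound on `g` and an upper bound on `g'` control both terms
of the increment. -/
lemma C11On.log {d : ℕ} {C : Set (Euc d)} {g : Euc d → ℝ} {g' : Euc d → Euc d} {L B m : ℝ}
    (hg : C11On C g g' L) (hC : Convex ℝ C) (hm : 0 < m) (hgm : ∀ x ∈ C, m ≤ g x) (hB : 0 ≤ B)
    (hgB : ∀ x ∈ C, ‖g' x‖ ≤ B) :
    C11On C (fun x => Real.log (g x)) (fun x => (g x)⁻¹ • g' x) (L / m + B * B / m ^ 2) where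
  nonneg := by have := hg.nonneg; positivity
  hasGradient x hx := hasGradientWithinAt_log (hg.hasGradient x hx) (hm.trans_le (hgm x hx)).ne'
  lip x hx y hy := by
    have hgx := hm.trans_le (hgm x hx)
    have hgy := hm.trans_le (hgm y hy)
    have e : (g x)⁻¹ • g' x - (g y)⁻¹ • g' y
        = (g x)⁻¹ • (g' x - g' y) + ((g y - g x) / (g x * g y)) • g' y := by
      have : (g y - g x) / (g x * g y) = (g x)⁻¹ - (g y)⁻¹ := by field_simp
      rw [this, smul_sub, sub_smul]
      abel
    rw [e]
    refine (norm_add_le _ _).trans ?_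
    rw [add_mul, norm_smul, norm_smul]
    gcongr ?_ + ?_
    · rw [norm_inv, Real.norm_eq_abs, abs_of_pos hgx, div_mul_eq_mul_div, inv_mul_eq_div]
      have := hg.lip x hx y hy
      have := hgm x hx
      have := hg.nonneg
      gcongr
    · have h1 := C11On.lipschitz hC hg.hasGradient hgB hx hy
      rw [norm_div, Real.norm_eq_abs, Real.norm_eq_abs, abs_of_pos (mul_pos hgx hgy),
        norm_sub_rev x y]
      have h2 : m ^ 2 ≤ g x * g y := by
        rw [pow_two]; exact mul_le_mul (hgm x hx) (hgm y hy) hm.le hgx.le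
      calc |g y - g x| / (g x * g y) * ‖g' y‖ ≤ (B * ‖y - x‖) / m ^ 2 * B := by
            have := hgB y hy
            gcongr
        _ = B * B / m ^ 2 * ‖y - x‖ := by ring

/-! ### The Gaussian kernel and its gradient -/

section Kernel

variable {d : ℕ} {ε : ℝ}

/-- The gradient of the Gaussian kernel. -/
noncomputable def gaussGrad (ε : ℝ) (x : Euc d) : Euc d := -(gaussKernel ε x / ε) • x

lemma gaussKernel_pos (x : Euc d) : 0 < gaussKernel ε x := Real.exp_pos _

lemma gaussKernel_le_one (hε : 0 < ε) (x : Euc d) : gaussKernel ε x ≤ 1 := by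
  rw [gaussKernel, Real.exp_le_one_iff]
  have : 0 ≤ ‖x‖ ^ 2 / (2 * ε) := by positivity
  linarith

lemma gaussKernel_neg (x : Euc d) : gaussKernel ε (-x) = gaussKernel ε x := by
  simp [gaussKernel]

lemma continuous_gaussKernel : Continuous (gaussKernel ε : Euc d → ℝ) := by
  unfold gaussKernel
  fun_prop

lemma continuous_gaussGrad : Continuous (gaussGrad ε : Euc d → Euc d) := by
  unfold gaussGrad
  have := continuous_gaussKernel (d := d) (ε := ε)
  fun_prop

lemma hasGradientAt_gaussKernel (hε : 0 < ε) (x : Euc d) :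
    HasGradientAt (gaussKernel ε) (gaussGrad ε x) x := by
  rw [hasGradientAt_iff_hasFDerivAt]
  have h1 : HasFDerivAt (fun x : Euc d => ‖x‖ ^ 2) (2 • innerSL ℝ x) x :=
    (hasStrictFDerivAt_norm_sq x).hasFDerivAt
  have h2 := ((h1.mul_const (2 * ε)⁻¹).neg).exp
  refine (h2.congr_fderiv ?_).congr_of_eventuallyEq
    (Eventually.of_forall fun y => by simp [gaussKernel, div_eq_mul_inv])
  ext y
  simp only [gaussGrad, gaussKernel, map_smul, smul_apply,
    neg_apply, innerSL_apply_apply, InnerProductSpace.toDual_apply_apply,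
    smul_eq_mul, div_eq_mul_inv, nsmul_eq_mul]
  field_simp
  simp
  ring

lemma hasGradientWithinAt_gaussKernel (hε : 0 < ε) (x : Euc d) (s : Set (Euc d)) :
    HasGradientWithinAt (gaussKernel ε) (gaussGrad ε x) s x :=
  (hasGradientAt_gaussKernel hε x).hasFDerivAt.hasFDerivWithinAt

lemma norm_gaussGrad_le (hε : 0 < ε) (x : Euc d) : ‖gaussGrad ε x‖ ≤ ‖x‖ / ε := by
  rw [gaussGrad, norm_smul, norm_neg, norm_div, Real.norm_eq_abs, Real.norm_eq_abs,
    abs_of_pos (gaussKernel_pos x), abs_of_pos hε, div_mul_eq_mul_div]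
  gcongr
  exact mul_le_of_le_one_left (norm_nonneg _) (gaussKernel_le_one hε x)

/-- On a ball, the Gaussian kernel has a bounded and Lipschitz gradient. -/
lemma exists_gaussKernel_c11On (hε : 0 < ε) {D : ℝ} (hD : 0 ≤ D) :
    ∃ L, C11On (Metric.closedBall (0 : Euc d) D) (gaussKernel ε) (gaussGrad ε) L ∧
      ∀ z ∈ Metric.closedBall (0 : Euc d) D, ‖gaussGrad ε z‖ ≤ L := by
  have hB : ∀ z ∈ Metric.closedBall (0 : Euc d) D, ‖gaussGrad ε z‖ ≤ D / ε := fun z hz =>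
    (norm_gaussGrad_le hε z).trans (by
      gcongr; simpa using hz)
  have hlip : ∀ x ∈ Metric.closedBall (0 : Euc d) D, ∀ y ∈ Metric.closedBall (0 : Euc d) D,
      ‖gaussGrad ε x - gaussGrad ε y‖ ≤ (1 + D * (D / ε)) / ε * ‖x - y‖ := by
    intro x hx y hy
    -- Product rule in difference form; the bound `hB` on the gradient makes the kernel itself
    -- Lipschitz for the second term.
    have e : gaussGrad ε x - gaussGrad ε y = -(ε⁻¹ • (gaussKernel ε x • (x - y) +
        (gaussKernel ε x - gaussKernel ε y) • y)) := by
      simp only [gaussGrad, div_eq_inv_mul, neg_smul, mul_smul, smul_sub, sub_smul, smul_add]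
      abel
    have h1 := C11On.lipschitz (convex_closedBall (0 : Euc d) D)
      (fun z _ => hasGradientWithinAt_gaussKernel hε z _) hB hy hx
    rw [e, norm_neg, norm_smul, norm_inv, Real.norm_eq_abs, abs_of_pos hε, div_mul_eq_mul_div,
      inv_mul_eq_div]
    gcongr
    refine (norm_add_le _ _).trans ?_
    rw [norm_smul, norm_smul, Real.norm_eq_abs, Real.norm_eq_abs,
      abs_of_pos (gaussKernel_pos x), add_mul]
    gcongr ?_ * _ + ?_
    · exact gaussKernel_le_one hε x
    · have hy' : ‖y‖ ≤ D := by simpa using hy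
      calc |gaussKernel ε x - gaussKernel ε y| * ‖y‖ ≤ (D / ε * ‖x - y‖) * D := by gcongr
        _ = D * (D / ε) * ‖x - y‖ := by ring
  refine ⟨max (D / ε) ((1 + D * (D / ε)) / ε), ⟨le_max_of_le_left (by positivity),
    fun z _ => hasGradientWithinAt_gaussKernel hε z _, fun x hx y hy => ?_⟩,
    fun z hz => (hB z hz).trans (le_max_left _ _)⟩
  exact (hlip x hx y hy).trans (by gcongr; exact le_max_right _ _)

end Kernel


/-! ### Averages of translates and couplings on a bounded set -/

section Average

variable {d : ℕ} {C : Set (Euc d)} {ρ ν : Measure (Euc d)}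
  {F : Type*} [NormedAddCommGroup F]

/-- `C` need not be Borel, so the argument passes to a measurable subset of `C` of full measure. -/
lemma aestronglyMeasurable_of_continuousOn (hρ : ρ Cᶜ = 0) {g : Euc d → F}
    (hg : ContinuousOn g C) : AEStronglyMeasurable g ρ := by
  obtain ⟨N, hN, hNm, hN0⟩ := exists_measurable_superset_of_null hρ
  have h1 : AEStronglyMeasurable g (ρ.restrict Nᶜ) :=
    (hg.mono (compl_subset_comm.1 hN)).aestronglyMeasurable hNm.compl
  have h2 : ∀ᵐ x ∂ρ, x ∈ Nᶜ := compl_mem_ae_iff.2 hN0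
  rwa [Measure.restrict_eq_self_of_ae_mem h2] at h1

lemma integrable_of_continuousOn [IsFiniteMeasure ρ] (hρ : ρ Cᶜ = 0) {g : Euc d → F}
    (hg : ContinuousOn g C) {B : ℝ} (hB : ∀ x ∈ C, ‖g x‖ ≤ B) : Integrable g ρ := by
  refine Integrable.of_bound (aestronglyMeasurable_of_continuousOn hρ hg) B ?_
  filter_upwards [mem_ae_iff.2 hρ] with x hx using hB x hx

lemma C11On.integrable {g : Euc d → ℝ} {g' : Euc d → Euc d} {L : ℝ} (hg : C11On C g g' L)
    (hC : Convex ℝ C) (hb : Bornology.IsBounded C) [IsFiniteMeasure ρ] (hρ : ρ Cᶜ = 0) :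
    Integrable g ρ := by
  rcases C.eq_empty_or_nonempty with rfl | ⟨x₀, hx₀⟩
  · have : ρ = 0 := by simpa using hρ
    simp [this]
  obtain ⟨B, hB0, hB⟩ := hg.exists_norm_le hb
  obtain ⟨D, hD⟩ := Metric.isBounded_iff.1 hb
  refine integrable_of_continuousOn hρ hg.continuousOn (B := |g x₀| + B * D) fun x hx => ?_
  have h1 := C11On.lipschitz hC hg.hasGradient hB hx₀ hx
  have h2 : B * ‖x - x₀‖ ≤ B * D := mul_le_mul_of_nonneg_left
    (by rw [← dist_eq_norm]; exact hD hx hx₀) hB0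
  have h3 := abs_add_le (g x₀) (g x - g x₀)
  rw [add_sub_cancel] at h3
  rw [Real.norm_eq_abs]
  linarith

variable [NormedSpace ℝ F] {D : ℝ} (hD : ∀ x ∈ C, ∀ y ∈ C, ‖x - y‖ ≤ D)
include hD

/-- The weight `w` is there for the dual term, where it is `1 / (φ_ε * ρ)`; the plain convolution is
the case `w = 1`. -/
lemma integrable_smul_comp_sub [IsFiniteMeasure ρ] (hρ : ρ Cᶜ = 0) {w : Euc d → ℝ} {W : ℝ}
    (hw : AEStronglyMeasurable w ρ) (hW : ∀ᵐ y ∂ρ, ‖w y‖ ≤ W) {h : Euc d → F}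
    (hh : Continuous h) {x : Euc d} (hx : x ∈ C) : Integrable (fun y => w y • h (x - y)) ρ := by
  obtain ⟨B, hB⟩ := (isCompact_closedBall (0 : Euc d) D).exists_bound_of_continuousOn
    hh.continuousOn
  refine Integrable.of_bound (C := W * B) (hw.smul (by fun_prop)) ?_
  filter_upwards [hW, mem_ae_iff.2 hρ] with y hy hyC
  rw [norm_smul]
  exact mul_le_mul hy (hB _ (by simpa using hD x hx y hyC)) (norm_nonneg _)
    ((norm_nonneg _).trans hy)

lemma integrable_comp_sub [IsFiniteMeasure ρ] (hρ : ρ Cᶜ = 0) {h : Euc d → F}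
    (hh : Continuous h) {x : Euc d} (hx : x ∈ C) : Integrable (fun y => h (x - y)) ρ := by
  simpa using integrable_smul_comp_sub hD hρ (w := fun _ => (1 : ℝ)) (W := 1)
    aestronglyMeasurable_const (by simp) hh hx

/-- Averaging translates of a function with Lipschitz gradient gives such a function. -/
lemma C11On.average [IsProbabilityMeasure ρ] (hρ : ρ Cᶜ = 0) {k : Euc d → ℝ}
    {k' : Euc d → Euc d} {L : ℝ} (hk : C11On (Metric.closedBall 0 D) k k' L) (hkc : Continuous k)
    (hkc' : Continuous k') {w : Euc d → ℝ} {W : ℝ} (hW0 : 0 ≤ W)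
    (hw : AEStronglyMeasurable w ρ) (hW : ∀ᵐ y ∂ρ, ‖w y‖ ≤ W) :
    C11On C (fun x => ∫ y, w y * k (x - y) ∂ρ) (fun x => ∫ y, w y • k' (x - y) ∂ρ) (W * L) := by
  have hball : ∀ x ∈ C, ∀ y ∈ C, x - y ∈ Metric.closedBall (0 : Euc d) D := fun x hx y hy => by
    simpa using hD x hx y hy
  have hi : ∀ x ∈ C, Integrable (fun y => w y * k (x - y)) ρ := fun x hx =>
    integrable_smul_comp_sub hD hρ hw hW hkc hx
  have hi' : ∀ x ∈ C, Integrable (fun y => w y • k' (x - y)) ρ := fun x hx =>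
    integrable_smul_comp_sub hD hρ hw hW hkc' hx
  refine C11On.of_quadratic (mul_nonneg hW0 hk.nonneg) (fun x hx z hz => ?_)
    fun x hx z hz => ?_
  · have hin : inner ℝ (∫ y, w y • k' (x - y) ∂ρ) (z - x) =
        ∫ y, inner ℝ (z - x) (w y • k' (x - y)) ∂ρ := by
      rw [real_inner_comm, integral_inner (hi' x hx)]
    have hi2 : Integrable (fun y => inner ℝ (z - x) (w y • k' (x - y))) ρ :=
      (hi' x hx).const_inner _
    have hi3 : Integrable (fun y => w y * k (z - y) - w y * k (x - y)) ρ :=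
      (hi z hz).sub (hi x hx)
    rw [hin, ← integral_sub (hi z hz) (hi x hx), ← integral_sub hi3 hi2]
    have := norm_integral_le_of_norm_le_const (μ := ρ) (C := W * (L * ‖z - x‖ ^ 2))
      (f := fun y => w y * k (z - y) - w y * k (x - y) - inner ℝ (z - x) (w y • k' (x - y))) ?_
    · simpa [mul_assoc] using this
    filter_upwards [hW, mem_ae_iff.2 hρ] with y hy hyC
    have h1 := hk.quadratic (convex_closedBall _ _) (hball x hx y hyC) (hball z hz y hyC)
    rw [sub_sub_sub_cancel_right] at h1
    have e : w y * k (z - y) - w y * k (x - y) - inner ℝ (z - x) (w y • k' (x - y)) =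
        w y * (k (z - y) - k (x - y) - inner ℝ (k' (x - y)) (z - x)) := by
      rw [inner_smul_right, real_inner_comm]
      ring
    rw [e, norm_mul]
    exact mul_le_mul hy h1 (norm_nonneg _) hW0
  · rw [← integral_sub (hi' x hx) (hi' z hz)]
    have := norm_integral_le_of_norm_le_const (μ := ρ) (C := W * (L * ‖x - z‖))
      (f := fun y => w y • k' (x - y) - w y • k' (z - y)) ?_
    · simpa [mul_assoc] using this
    filter_upwards [hW, mem_ae_iff.2 hρ] with y hy hyC
    have h1 := hk.lip _ (hball x hx y hyC) _ (hball z hz y hyC)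
    rw [sub_sub_sub_cancel_right] at h1
    rw [← smul_sub, norm_smul]
    exact mul_le_mul hy h1 (norm_nonneg _) hW0

lemma integrable_norm_sub_of_mem_couplings [IsProbabilityMeasure ρ] (hρ : ρ Cᶜ = 0)
    (hν : ν Cᶜ = 0) {γ : Measure (Euc d × Euc d)} (hγ : γ ∈ couplings ρ ν) (n : ℕ) :
    Integrable (fun p : Euc d × Euc d => ‖p.1 - p.2‖ ^ n) γ := by
  have := isProbabilityMeasure_of_mem_couplings hγ
  refine Integrable.of_bound (C := D ^ n) (by fun_prop) ?_
  filter_upwards [ae_prod_of_mem_couplings hγ (mem_ae_iff.2 hρ) (mem_ae_iff.2 hν)] with p hp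
  rw [norm_pow, norm_norm]
  have := hD _ hp.1 _ hp.2
  gcongr

/-- The first moment of a coupling controls the change of averages of Lipschitz functions. -/
lemma norm_average_sub_average_le [IsProbabilityMeasure ρ] [IsProbabilityMeasure ν]
    (hρ : ρ Cᶜ = 0) (hν : ν Cᶜ = 0)
    {γ : Measure (Euc d × Euc d)} (hγ : γ ∈ couplings ρ ν) {h : Euc d → F} (hh : Continuous h)
    {L : ℝ} (hL : ∀ x ∈ Metric.closedBall (0 : Euc d) D, ∀ y ∈ Metric.closedBall (0 : Euc d) D,
      ‖h x - h y‖ ≤ L * ‖x - y‖) {x : Euc d} (hx : x ∈ C) :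
    ‖∫ y, h (x - y) ∂ν - ∫ y, h (x - y) ∂ρ‖ ≤ L * ∫ p, ‖p.1 - p.2‖ ∂γ := by
  have hc : Continuous fun y => h (x - y) := by fun_prop
  have hi1 : Integrable (fun p : Euc d × Euc d => h (x - p.1)) γ := by
    have := integrable_comp_sub hD hρ hh hx
    rw [← hγ.1] at this
    exact this.comp_measurable measurable_fst
  have hi2 : Integrable (fun p : Euc d × Euc d => h (x - p.2)) γ := by
    have := integrable_comp_sub hD hν hh hx
    rw [← hγ.2] at this
    exact this.comp_measurable measurable_snd
  have e1 : ∫ y, h (x - y) ∂ρ = ∫ p, h (x - p.1) ∂γ := by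
    conv_lhs => rw [← hγ.1]
    exact integral_map measurable_fst.aemeasurable hc.aestronglyMeasurable
  have e2 : ∫ y, h (x - y) ∂ν = ∫ p, h (x - p.2) ∂γ := by
    conv_lhs => rw [← hγ.2]
    exact integral_map measurable_snd.aemeasurable hc.aestronglyMeasurable
  rw [e1, e2, ← integral_sub hi2 hi1, ← integral_const_mul]
  have hi := integrable_norm_sub_of_mem_couplings hD hρ hν hγ 1
  simp only [pow_one] at hi
  refine norm_integral_le_of_norm_le (hi.const_mul L) ?_
  filter_upwards [ae_prod_of_mem_couplings hγ (mem_ae_iff.2 hρ) (mem_ae_iff.2 hν)] with p hp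
  have := hL (x - p.2) (by simpa using hD x hx _ hp.2) (x - p.1) (by simpa using hD x hx _ hp.1)
  rwa [sub_sub_sub_cancel_left] at this

end Average

/-! ### The Gaussian convolution and the candidate first variation -/

section FirstVariation

variable {d : ℕ} {ε : ℝ}

/-- The gradient of the Gaussian convolution. -/
noncomputable def gaussConvGrad (ε : ℝ) (ρ : Measure (Euc d)) (x : Euc d) : Euc d :=
  ∫ y, gaussGrad ε (x - y) ∂ρ

/-- The first variation of the interaction part of `regKL`. -/
noncomputable def dualConv (ε : ℝ) (ρ : Measure (Euc d)) (x : Euc d) : ℝ :=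
  ∫ y, (gaussConv ε ρ y)⁻¹ * gaussKernel ε (x - y) ∂ρ

/-- The gradient of `dualConv`. -/
noncomputable def dualConvGrad (ε : ℝ) (ρ : Measure (Euc d)) (x : Euc d) : Euc d :=
  ∫ y, (gaussConv ε ρ y)⁻¹ • gaussGrad ε (x - y) ∂ρ

/-- The first variation of `regKL`. -/
noncomputable def firstVar (U : Euc d → ℝ) (ε : ℝ) (ρ : Measure (Euc d)) (x : Euc d) : ℝ :=
  U x + Real.log (gaussConv ε ρ x) + dualConv ε ρ x

/-- The gradient of the first variation of `regKL`. -/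
noncomputable def firstVarGrad (gradU : Euc d → Euc d) (ε : ℝ) (ρ : Measure (Euc d))
    (x : Euc d) : Euc d :=
  gradU x + (gaussConv ε ρ x)⁻¹ • gaussConvGrad ε ρ x + dualConvGrad ε ρ x

lemma continuous_gaussConv (hε : 0 < ε) (ρ : Measure (Euc d)) [IsFiniteMeasure ρ] :
    Continuous (gaussConv ε ρ) := by
  have hk := continuous_gaussKernel (d := d) (ε := ε)
  refine continuous_of_dominated (bound := fun _ => 1) (fun x => by fun_prop)
    (fun x => ae_of_all _ fun y => ?_) (integrable_const _) (ae_of_all _ fun y => by fun_prop)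
  rw [Real.norm_eq_abs, abs_of_pos (gaussKernel_pos _)]
  exact gaussKernel_le_one hε _

variable {C : Set (Euc d)} {D : ℝ} {ρ ν : Measure (Euc d)}

/-- The kernel is at least this constant at differences of points of `C`. The bound does not depend
on `ρ`, so the logarithm is uniformly smooth over all laws on `C`. -/
lemma exp_le_gaussConv (hε : 0 < ε) (hD : ∀ x ∈ C, ∀ y ∈ C, ‖x - y‖ ≤ D)
    [IsProbabilityMeasure ρ] (hρ : ρ Cᶜ = 0) {x : Euc d} (hx : x ∈ C) :
    Real.exp (-(D ^ 2 / (2 * ε))) ≤ gaussConv ε ρ x := by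
  have hi := integrable_comp_sub hD hρ (continuous_gaussKernel (ε := ε)) hx
  have := integral_mono_ae (integrable_const (Real.exp (-(D ^ 2 / (2 * ε))))) hi ?_
  · simpa [gaussConv] using this
  filter_upwards [mem_ae_iff.2 hρ] with y hy
  have := hD x hx y hy
  simp only [gaussKernel]
  gcongr

end FirstVariation


/-! ### First-order expansion of the functional -/

/-- Apply `log t ≤ t - 1` at `t = b / a` and at `t = a / b`: the first bounds the remainder above by
`0`, the second below by `-(b - a)² / (ab)`. -/
lemma abs_log_sub_log_sub_div_le {a b m : ℝ} (hm : 0 < m) (ha : m ≤ a) (hb : m ≤ b) :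
    |Real.log b - Real.log a - (b - a) / a| ≤ (b - a) ^ 2 / m ^ 2 := by
  have ha0 := hm.trans_le ha
  have hb0 := hm.trans_le hb
  have h1 := Real.log_le_sub_one_of_pos (div_pos hb0 ha0)
  have h2 := Real.log_le_sub_one_of_pos (div_pos ha0 hb0)
  rw [Real.log_div hb0.ne' ha0.ne'] at h1
  rw [Real.log_div ha0.ne' hb0.ne'] at h2
  have e1 : (b - a) / a = b / a - 1 := by field_simp
  have e2 : (b - a) ^ 2 / (a * b) = (b / a - 1) + (a / b - 1) := by field_simp; ring
  have h3 : (b - a) ^ 2 / (a * b) ≤ (b - a) ^ 2 / m ^ 2 := by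
    rw [pow_two m]; gcongr
  rw [abs_le, e1]
  constructor
  · linarith
  · have : 0 ≤ (b - a) ^ 2 / m ^ 2 := by positivity
    linarith

section Expansion

variable {d : ℕ} {ε : ℝ} {C : Set (Euc d)} {D L : ℝ} {ρ ν : Measure (Euc d)}
  [IsProbabilityMeasure ρ] [IsProbabilityMeasure ν]

lemma gaussConv_c11On (hD : ∀ x ∈ C, ∀ y ∈ C, ‖x - y‖ ≤ D)
    (hk : C11On (Metric.closedBall (0 : Euc d) D) (gaussKernel ε) (gaussGrad ε) L)
    (hρ : ρ Cᶜ = 0) : C11On C (gaussConv ε ρ) (gaussConvGrad ε ρ) L := by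
  have := C11On.average hD hρ hk continuous_gaussKernel continuous_gaussGrad zero_le_one
    (w := fun _ => 1) aestronglyMeasurable_const (by simp)
  simp only [one_mul, one_smul] at this
  exact this

lemma norm_gaussConvGrad_le (hD : ∀ x ∈ C, ∀ y ∈ C, ‖x - y‖ ≤ D)
    (hkB : ∀ z ∈ Metric.closedBall (0 : Euc d) D, ‖gaussGrad ε z‖ ≤ L)
    (hρ : ρ Cᶜ = 0) {x : Euc d} (hx : x ∈ C) : ‖gaussConvGrad ε ρ x‖ ≤ L := by
  have := norm_integral_le_of_norm_le_const (μ := ρ) (C := L)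
    (f := fun y => gaussGrad ε (x - y)) ?_
  · simpa [gaussConvGrad] using this
  filter_upwards [mem_ae_iff.2 hρ] with y hy using hkB _ (by simpa using hD x hx y hy)

lemma ae_norm_inv_gaussConv_le (hε : 0 < ε) (hD : ∀ x ∈ C, ∀ y ∈ C, ‖x - y‖ ≤ D)
    (hρ : ρ Cᶜ = 0) :
    ∀ᵐ y ∂ρ, ‖(gaussConv ε ρ y)⁻¹‖ ≤ (Real.exp (-(D ^ 2 / (2 * ε))))⁻¹ := by
  filter_upwards [mem_ae_iff.2 hρ] with y hy
  have h := exp_le_gaussConv hε hD hρ hy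
  have h0 := Real.exp_pos (-(D ^ 2 / (2 * ε)))
  rw [norm_inv, Real.norm_eq_abs, abs_of_pos (h0.trans_le h)]
  gcongr

lemma dualConv_c11On (hε : 0 < ε) (hD : ∀ x ∈ C, ∀ y ∈ C, ‖x - y‖ ≤ D)
    (hk : C11On (Metric.closedBall (0 : Euc d) D) (gaussKernel ε) (gaussGrad ε) L)
    (hρ : ρ Cᶜ = 0) : C11On C (dualConv ε ρ) (dualConvGrad ε ρ)
      ((Real.exp (-(D ^ 2 / (2 * ε))))⁻¹ * L) :=
  C11On.average hD hρ hk continuous_gaussKernel continuous_gaussGrad (by positivity)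
    (continuous_gaussConv hε ρ).measurable.inv.aestronglyMeasurable
    (ae_norm_inv_gaussConv_le hε hD hρ)

lemma log_gaussConv_c11On (hε : 0 < ε) (hC : Convex ℝ C) (hD : ∀ x ∈ C, ∀ y ∈ C, ‖x - y‖ ≤ D)
    (hk : C11On (Metric.closedBall (0 : Euc d) D) (gaussKernel ε) (gaussGrad ε) L)
    (hkB : ∀ z ∈ Metric.closedBall (0 : Euc d) D, ‖gaussGrad ε z‖ ≤ L)
    (hρ : ρ Cᶜ = 0) : ∃ M, C11On C (fun x => Real.log (gaussConv ε ρ x))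
      (fun x => (gaussConv ε ρ x)⁻¹ • gaussConvGrad ε ρ x) M :=
  ⟨_, (gaussConv_c11On hD hk hρ).log hC (Real.exp_pos _)
    (fun _ hx => exp_le_gaussConv hε hD hρ hx) hk.nonneg
    (fun _ hx => norm_gaussConvGrad_le hD hkB hρ hx)⟩

lemma firstVar_c11On (hε : 0 < ε) (hC : Convex ℝ C) (hD : ∀ x ∈ C, ∀ y ∈ C, ‖x - y‖ ≤ D)
    (hD0 : 0 ≤ D) (hρ : ρ Cᶜ = 0) {U : Euc d → ℝ} {gradU : Euc d → Euc d} {M : ℝ}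
    (hU : C11On C U gradU M) :
    ∃ M', C11On C (firstVar U ε ρ) (firstVarGrad gradU ε ρ) M' := by
  obtain ⟨L, hk, hkB⟩ := exists_gaussKernel_c11On (d := d) hε hD0
  obtain ⟨M₂, h₂⟩ := log_gaussConv_c11On hε hC hD hk hkB hρ
  exact ⟨_, (hU.add h₂).add (dualConv_c11On hε hD hk hρ)⟩

/-- Fubini for the interaction term. -/
lemma integral_dualConv (hε : 0 < ε) (hD : ∀ x ∈ C, ∀ y ∈ C, ‖x - y‖ ≤ D) (hρ : ρ Cᶜ = 0) :
    ∫ x, dualConv ε ρ x ∂ν = ∫ x, (gaussConv ε ρ x)⁻¹ * gaussConv ε ν x ∂ρ := by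
  unfold dualConv
  rw [integral_integral_swap]
  · refine integral_congr_ae (ae_of_all _ fun y => ?_)
    simp only
    rw [integral_const_mul, gaussConv]
    congr 2
    ext x
    -- Evenness of the kernel identifies the inner integral as a convolution evaluated at `y`.
    rw [← gaussKernel_neg, neg_sub]
  · have hw : Integrable (fun y => (gaussConv ε ρ y)⁻¹) ρ := Integrable.of_bound
      (continuous_gaussConv hε ρ).measurable.inv.aestronglyMeasurable _
      (ae_norm_inv_gaussConv_le hε hD hρ)
    have hk := continuous_gaussKernel (d := d) (ε := ε)
    refine (hw.comp_snd ν).mul_bdd (c := 1) (Continuous.aestronglyMeasurable (by fun_prop))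
      (ae_of_all _ fun p => ?_)
    rw [Real.norm_eq_abs, abs_of_pos (gaussKernel_pos _)]
    exact gaussKernel_le_one hε _

/-- The first-order expansion of `regKL` with a quadratic remainder in the first moment of an
arbitrary coupling. -/
lemma exists_regKL_expansion (hε : 0 < ε) (hC : Convex ℝ C) (hb : Bornology.IsBounded C)
    (hD : ∀ x ∈ C, ∀ y ∈ C, ‖x - y‖ ≤ D)
    (hD0 : 0 ≤ D) (hρ : ρ Cᶜ = 0) {U : Euc d → ℝ} {gradU : Euc d → Euc d} {M : ℝ}
    (hU : C11On C U gradU M) :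
    ∃ c, 0 ≤ c ∧ ∀ ν : Measure (Euc d), IsProbabilityMeasure ν → ν Cᶜ = 0 →
      ∀ γ ∈ couplings ρ ν,
        |regKL U ε ν - regKL U ε ρ - (∫ x, firstVar U ε ρ x ∂ν - ∫ x, firstVar U ε ρ x ∂ρ)| ≤
          c * (∫ p, ‖p.1 - p.2‖ ∂γ) ^ 2 := by
  obtain ⟨L, hk, hkB⟩ := exists_gaussKernel_c11On (d := d) hε hD0
  have hL := hk.nonneg
  obtain ⟨m, hm⟩ : ∃ m, m = Real.exp (-(D ^ 2 / (2 * ε))) := ⟨_, rfl⟩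
  have hm0 : 0 < m := hm ▸ Real.exp_pos _
  -- The first two summands come from the Lipschitz constant of the increment of the logarithms, the
  -- last from the Taylor error of the logarithm.
  refine ⟨L / m + L * L / m ^ 2 + L ^ 2 / m ^ 2, by positivity, fun ν _ hν γ hγ => ?_⟩
  have hγp := isProbabilityMeasure_of_mem_couplings hγ
  obtain ⟨e, he⟩ : ∃ e, e = ∫ p, ‖p.1 - p.2‖ ∂γ := ⟨_, rfl⟩
  have he0 : 0 ≤ e := he ▸ integral_nonneg fun p => norm_nonneg _
  have hα : ∀ x ∈ C, m ≤ gaussConv ε ρ x := fun x hx => hm ▸ exp_le_gaussConv hε hD hρ hx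
  have hβ : ∀ x ∈ C, m ≤ gaussConv ε ν x := fun x hx => hm ▸ exp_le_gaussConv hε hD hν hx
  have hklip : ∀ x ∈ Metric.closedBall (0 : Euc d) D, ∀ y ∈ Metric.closedBall (0 : Euc d) D,
      ‖gaussKernel ε x - gaussKernel ε y‖ ≤ L * ‖x - y‖ := fun x hx y hy =>
    C11On.lipschitz (convex_closedBall _ _) hk.hasGradient hkB hy hx
  have hd : ∀ x ∈ C, |gaussConv ε ν x - gaussConv ε ρ x| ≤ L * e := fun x hx => by
    rw [he]
    exact norm_average_sub_average_le hD hρ hν hγ continuous_gaussKernel hklip hx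
  have hd' : ∀ x ∈ C, ‖gaussConvGrad ε ν x - gaussConvGrad ε ρ x‖ ≤ L * e := fun x hx => by
    rw [he]
    exact norm_average_sub_average_le hD hρ hν hγ continuous_gaussGrad hk.lip hx
  obtain ⟨_, hlogρ⟩ := log_gaussConv_c11On hε hC hD hk hkB hρ
  obtain ⟨_, hlogν⟩ := log_gaussConv_c11On hε hC hD hk hkB hν
  have hB := dualConv_c11On hε hD hk hρ
  -- the increment of the logarithms is Lipschitz with a small constant
  have hgrad : ∀ x ∈ C, HasGradientWithinAt
      (fun x => Real.log (gaussConv ε ν x) - Real.log (gaussConv ε ρ x))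
      ((gaussConv ε ν x)⁻¹ • gaussConvGrad ε ν x - (gaussConv ε ρ x)⁻¹ • gaussConvGrad ε ρ x)
      C x := fun x hx => by
    have := (hlogν.hasGradient x hx).hasFDerivWithinAt.sub
      (hlogρ.hasGradient x hx).hasFDerivWithinAt
    rw [← map_sub] at this
    exact this
  have hgradB : ∀ x ∈ C,
      ‖(gaussConv ε ν x)⁻¹ • gaussConvGrad ε ν x - (gaussConv ε ρ x)⁻¹ • gaussConvGrad ε ρ x‖ ≤
        (L / m + L * L / m ^ 2) * e := fun x hx => by
    have ha := hm0.trans_le (hα x hx)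
    have hb := hm0.trans_le (hβ x hx)
    have e1 : (gaussConv ε ν x)⁻¹ • gaussConvGrad ε ν x -
        (gaussConv ε ρ x)⁻¹ • gaussConvGrad ε ρ x =
        (gaussConv ε ν x)⁻¹ • (gaussConvGrad ε ν x - gaussConvGrad ε ρ x) -
        ((gaussConv ε ν x - gaussConv ε ρ x) / (gaussConv ε ν x * gaussConv ε ρ x)) •
          gaussConvGrad ε ρ x := by
      have : (gaussConv ε ν x - gaussConv ε ρ x) / (gaussConv ε ν x * gaussConv ε ρ x) =
          (gaussConv ε ρ x)⁻¹ - (gaussConv ε ν x)⁻¹ := by field_simp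
      rw [this, smul_sub, sub_smul]
      abel
    rw [e1]
    refine (norm_sub_le _ _).trans ?_
    rw [norm_smul, norm_smul, norm_inv, norm_div, Real.norm_eq_abs, Real.norm_eq_abs,
      Real.norm_eq_abs, abs_of_pos hb, abs_of_pos (mul_pos hb ha), add_mul]
    gcongr ?_ + ?_
    · have h1 := hd' x hx
      have h2 := hβ x hx
      calc (gaussConv ε ν x)⁻¹ * ‖gaussConvGrad ε ν x - gaussConvGrad ε ρ x‖ ≤ m⁻¹ * (L * e) := by
            gcongr
        _ = L / m * e := by ring
    · have h1 := hd x hx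
      have h2 : m ^ 2 ≤ gaussConv ε ν x * gaussConv ε ρ x := by
        rw [pow_two]; exact mul_le_mul (hβ x hx) (hα x hx) hm0.le hb.le
      have h3 := norm_gaussConvGrad_le hD hkB hρ hx
      calc |gaussConv ε ν x - gaussConv ε ρ x| / (gaussConv ε ν x * gaussConv ε ρ x) *
            ‖gaussConvGrad ε ρ x‖ ≤ (L * e) / m ^ 2 * L := by gcongr
        _ = L * L / m ^ 2 * e := by ring
  have hlip : ∀ x ∈ C, ∀ y ∈ C,
      |Real.log (gaussConv ε ν y) - Real.log (gaussConv ε ρ y) -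
        (Real.log (gaussConv ε ν x) - Real.log (gaussConv ε ρ x))| ≤
      (L / m + L * L / m ^ 2) * e * ‖y - x‖ := fun x hx y hy =>
    C11On.lipschitz hC hgrad hgradB hx hy
  -- integrability
  have iU1 := hU.integrable hC hb hρ
  have iU2 := hU.integrable hC hb hν
  have ia1 := hlogρ.integrable hC hb hρ
  have ia2 := hlogρ.integrable hC hb hν
  have ib1 := hlogν.integrable hC hb hρ
  have ib2 := hlogν.integrable hC hb hν
  have iB1 := hB.integrable hC hb hρ
  have iB2 := hB.integrable hC hb hν
  have ih1 := ib1.sub ia1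
  have ih2 := ib2.sub ia2
  have hcr := continuous_gaussConv hε ρ
  have hcn := continuous_gaussConv hε ν
  have iq : Integrable (fun x => (gaussConv ε ν x - gaussConv ε ρ x) / gaussConv ε ρ x) ρ := by
    refine Integrable.of_bound (C := L * e / m)
      (Measurable.aestronglyMeasurable (by
        have := hcr.measurable
        have := hcn.measurable
        fun_prop)) ?_
    filter_upwards [mem_ae_iff.2 hρ] with x hx
    have h1 := hd x hx
    have h2 := hα x hx
    rw [norm_div, Real.norm_eq_abs, Real.norm_eq_abs, abs_of_pos (hm0.trans_le h2)]
    gcongr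
  -- The dual term integrated against `ν - ρ` is exactly the linearisation of `ν ↦ ∫ ln (φ_ε * ν)
  -- dρ` at `ρ`.
  have hFub : ∫ x, dualConv ε ρ x ∂ν - ∫ x, dualConv ε ρ x ∂ρ =
      ∫ x, (gaussConv ε ν x - gaussConv ε ρ x) / gaussConv ε ρ x ∂ρ := by
    have i1 : ∀ μ : Measure (Euc d), IsProbabilityMeasure μ → μ Cᶜ = 0 →
        Integrable (fun x => (gaussConv ε ρ x)⁻¹ * gaussConv ε μ x) ρ := by
      intro μ _ hμ
      refine Integrable.of_bound (C := m⁻¹ * 1)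
        (Measurable.aestronglyMeasurable (by
          have := hcr.measurable
          have := (continuous_gaussConv hε μ).measurable
          fun_prop)) ?_
      filter_upwards [mem_ae_iff.2 hρ] with x hx
      have h2 := hα x hx
      have h3 : ‖gaussConv ε μ x‖ ≤ 1 := by
        have := norm_integral_le_of_norm_le_const (μ := μ) (C := 1)
          (f := fun y => gaussKernel ε (x - y)) (ae_of_all _ fun y => by
            rw [Real.norm_eq_abs, abs_of_pos (gaussKernel_pos _)]
            exact gaussKernel_le_one hε _)
        simpa [gaussConv] using this
      rw [norm_mul, norm_inv, Real.norm_eq_abs, abs_of_pos (hm0.trans_le h2)]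
      gcongr
    rw [integral_dualConv hε hD hρ, integral_dualConv hε hD hρ,
      ← integral_sub (i1 ν inferInstance hν) (i1 ρ inferInstance hρ)]
    refine integral_congr_ae (ae_of_all _ fun x => ?_)
    simp only
    ring
  -- The remainder is the increment of the logarithms integrated against `ν - ρ`, plus its
  -- linearisation error integrated against `ρ`. Each is of second order: the increment has
  -- Lipschitz constant `O(e)` and mass is moved by `e` on average, while the linearisation error is
  -- `O(e²)` pointwise on `C`.
  have key : regKL U ε ν - regKL U ε ρ -
      (∫ x, firstVar U ε ρ x ∂ν - ∫ x, firstVar U ε ρ x ∂ρ) =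
      (∫ x, (Real.log (gaussConv ε ν x) - Real.log (gaussConv ε ρ x)) ∂ν -
        ∫ x, (Real.log (gaussConv ε ν x) - Real.log (gaussConv ε ρ x)) ∂ρ) +
      ∫ x, (Real.log (gaussConv ε ν x) - Real.log (gaussConv ε ρ x) -
        (gaussConv ε ν x - gaussConv ε ρ x) / gaussConv ε ρ x) ∂ρ := by
    have e1 : ∫ x, firstVar U ε ρ x ∂ν = ∫ x, U x ∂ν + ∫ x, Real.log (gaussConv ε ρ x) ∂ν +
        ∫ x, dualConv ε ρ x ∂ν := by
      rw [← integral_add iU2 ia2]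
      exact integral_add (iU2.add ia2) iB2
    have e2 : ∫ x, firstVar U ε ρ x ∂ρ = ∫ x, U x ∂ρ + ∫ x, Real.log (gaussConv ε ρ x) ∂ρ +
        ∫ x, dualConv ε ρ x ∂ρ := by
      rw [← integral_add iU1 ia1]
      exact integral_add (iU1.add ia1) iB1
    have e3 := integral_sub ih1 iq
    simp only [Pi.sub_apply] at e3
    rw [e1, e2, e3, ← hFub, regKL, regKL, integral_add iU2 ib2, integral_add iU1 ia1,
      integral_sub ib2 ia2]
    ring
  have hae := ae_prod_of_mem_couplings hγ (mem_ae_iff.2 hρ) (mem_ae_iff.2 hν)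
  have hm1 : MeasurePreserving Prod.fst γ ρ := ⟨measurable_fst, hγ.1⟩
  have hm2 : MeasurePreserving Prod.snd γ ν := ⟨measurable_snd, hγ.2⟩
  have ha1 : |∫ x, (Real.log (gaussConv ε ν x) - Real.log (gaussConv ε ρ x)) ∂ν -
        ∫ x, (Real.log (gaussConv ε ν x) - Real.log (gaussConv ε ρ x)) ∂ρ| ≤
      (L / m + L * L / m ^ 2) * e * e := by
    have j1 := hm1.integrable_comp_of_integrable ih1
    have j2 := hm2.integrable_comp_of_integrable ih2
    have e1 : ∫ x, (Real.log (gaussConv ε ν x) - Real.log (gaussConv ε ρ x)) ∂ρ =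
        ∫ p, (Real.log (gaussConv ε ν p.1) - Real.log (gaussConv ε ρ p.1)) ∂γ := by
      have := integral_map (μ := γ) measurable_fst.aemeasurable (hγ.1 ▸ ih1.aestronglyMeasurable)
      rw [hγ.1] at this
      exact this
    have e2 : ∫ x, (Real.log (gaussConv ε ν x) - Real.log (gaussConv ε ρ x)) ∂ν =
        ∫ p, (Real.log (gaussConv ε ν p.2) - Real.log (gaussConv ε ρ p.2)) ∂γ := by
      have := integral_map (μ := γ) measurable_snd.aemeasurable (hγ.2 ▸ ih2.aestronglyMeasurable)
      rw [hγ.2] at this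
      exact this
    have i3 := integrable_norm_sub_of_mem_couplings hD hρ hν hγ 1
    simp only [pow_one] at i3
    have e3 := integral_sub j2 j1
    simp only [Function.comp_def, Pi.sub_apply] at e3
    have e4 : (L / m + L * L / m ^ 2) * e * e =
        ∫ p, (L / m + L * L / m ^ 2) * e * ‖p.1 - p.2‖ ∂γ := by rw [integral_const_mul, ← he]
    rw [e1, e2, ← e3, e4, ← Real.norm_eq_abs]
    refine norm_integral_le_of_norm_le (i3.const_mul _) ?_
    filter_upwards [hae] with p hp
    rw [norm_sub_rev p.1 p.2]
    exact hlip _ hp.1 _ hp.2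
  have ha2 : |∫ x, (Real.log (gaussConv ε ν x) - Real.log (gaussConv ε ρ x) -
        (gaussConv ε ν x - gaussConv ε ρ x) / gaussConv ε ρ x) ∂ρ| ≤ L ^ 2 / m ^ 2 * e ^ 2 := by
    have := norm_integral_le_of_norm_le_const (μ := ρ) (C := L ^ 2 / m ^ 2 * e ^ 2)
      (f := fun x => Real.log (gaussConv ε ν x) - Real.log (gaussConv ε ρ x) -
        (gaussConv ε ν x - gaussConv ε ρ x) / gaussConv ε ρ x) ?_
    · simpa using this
    filter_upwards [mem_ae_iff.2 hρ] with x hx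
    refine (abs_log_sub_log_sub_div_le hm0 (hα x hx) (hβ x hx)).trans ?_
    rw [div_mul_eq_mul_div, ← mul_pow]
    have := sq_le_sq' (abs_le.1 (hd x hx)).1 (abs_le.1 (hd x hx)).2
    gcongr
  rw [key, ← he]
  refine (abs_add_le _ _).trans ?_
  calc _ ≤ (L / m + L * L / m ^ 2) * e * e + L ^ 2 / m ^ 2 * e ^ 2 := add_le_add ha1 ha2
    _ = _ := by ring

end Expansion


/-! ### First variations: existence and uniqueness up to constants -/

section FirstVariation

variable {d : ℕ} {C : Set (Euc d)} {D : ℝ} {ρ ν : Measure (Euc d)}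

lemma mix_zero (ρ ν : Measure (Euc d)) : mix ρ ν 0 = ρ := by simp [mix]

lemma isProbabilityMeasure_mix [IsProbabilityMeasure ρ] [IsProbabilityMeasure ν] {s : ℝ}
    (hs : s ∈ Icc (0 : ℝ) 1) : IsProbabilityMeasure (mix ρ ν s) := by
  constructor
  simp only [mix, Measure.add_apply, Measure.smul_apply, measure_univ, smul_eq_mul, mul_one]
  rw [← ENNReal.ofReal_add (by linarith [hs.2]) hs.1]
  simp

lemma mix_compl_eq_zero (hρ : ρ Cᶜ = 0) (hν : ν Cᶜ = 0) (s : ℝ) : mix ρ ν s Cᶜ = 0 := by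
  simp [mix, hρ, hν]

lemma integral_smul_add_smul {α : Type*} [MeasurableSpace α] {μ μ' : Measure α} {f : α → ℝ}
    (h1 : Integrable f μ) (h2 : Integrable f μ') {s : ℝ} (hs : s ∈ Icc (0 : ℝ) 1) :
    ∫ x, f x ∂(ENNReal.ofReal (1 - s) • μ + ENNReal.ofReal s • μ') =
      (1 - s) * ∫ x, f x ∂μ + s * ∫ x, f x ∂μ' := by
  rw [integral_add_measure (h1.smul_measure ENNReal.ofReal_ne_top)
    (h2.smul_measure ENNReal.ofReal_ne_top), integral_smul_measure, integral_smul_measure,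
    ENNReal.toReal_ofReal (by linarith [hs.2]), ENNReal.toReal_ofReal hs.1]
  simp

/-- Mass `1 - s` stays on the diagonal and only mass `s` moves. The first moment is therefore linear
in `s`, and its square is `O(s²)`. -/
lemma mix_mem_couplings [IsProbabilityMeasure ρ] [IsProbabilityMeasure ν] {s : ℝ}
    (hs : s ∈ Icc (0 : ℝ) 1) :
    ENNReal.ofReal (1 - s) • ρ.map (fun x => (x, x)) + ENNReal.ofReal s • ρ.prod ν ∈
      couplings ρ (mix ρ ν s) := by
  have hdiag := map_prodMk_mem_couplings ρ measurable_id measurable_id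
  simp only [Measure.map_id, id] at hdiag
  have hprod := prod_mem_couplings ρ ν
  constructor
  · rw [Measure.map_add _ _ measurable_fst, Measure.map_smul, Measure.map_smul, hdiag.1, hprod.1,
      ← add_smul, ← ENNReal.ofReal_add (by linarith [hs.2]) hs.1]
    simp
  · rw [Measure.map_add _ _ measurable_snd, Measure.map_smul, Measure.map_smul, hdiag.2, hprod.2,
      mix]

/-- An expansion with quadratic remainder in the first moment of couplings yields a first
variation. -/
lemma isFirstVariation_of_expansion (hD : ∀ x ∈ C, ∀ y ∈ C, ‖x - y‖ ≤ D)
    [IsProbabilityMeasure ρ] (hρ : ρ Cᶜ = 0) {F : Measure (Euc d) → ℝ} {f : Euc d → ℝ}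
    (hf : ∀ ν ∈ P2 C, Integrable f ν) (hfρ : Integrable f ρ) {c : ℝ} (hc : 0 ≤ c)
    (hexp : ∀ ν : Measure (Euc d), IsProbabilityMeasure ν → ν Cᶜ = 0 → ∀ γ ∈ couplings ρ ν,
      |F ν - F ρ - (∫ x, f x ∂ν - ∫ x, f x ∂ρ)| ≤ c * (∫ p, ‖p.1 - p.2‖ ∂γ) ^ 2) :
    IsFirstVariation C F ρ f := by
  refine ⟨hfρ, fun ν hν => ⟨hf ν hν, ?_⟩⟩
  have := hν.1
  have hgrad : HasGradientWithinAt (fun s : ℝ => F (mix ρ ν s))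
      (∫ x, f x ∂ν - ∫ x, f x ∂ρ) (Icc 0 1) 0 := by
    refine hasGradientWithinAt_of_quadratic (L := c * D ^ 2) (by simp) fun s hs => ?_
    have hp := isProbabilityMeasure_mix (ρ := ρ) (ν := ν) hs
    refine le_trans (le_of_eq ?_) ((hexp _ hp (mix_compl_eq_zero hρ hν.2.1 s) _
      (mix_mem_couplings hs)).trans ?_)
    · rw [mix_zero, show ∫ x, f x ∂(mix ρ ν s) = _ from
        integral_smul_add_smul hfρ (hf ν hν) hs]
      simp only [sub_zero, RCLike.inner_apply, conj_trivial]
      congr 1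
      ring
    · have i1 : Integrable (fun p : Euc d × Euc d => ‖p.1 - p.2‖) (ρ.map (fun x => (x, x))) := by
        rw [integrable_map_measure (by fun_prop) (by fun_prop)]
        simp [Function.comp_def]
      have i2 := integrable_norm_sub_of_mem_couplings hD hρ hν.2.1 (prod_mem_couplings ρ ν) 1
      simp only [pow_one] at i2
      rw [integral_smul_add_smul i1 i2 hs, integral_map (by fun_prop) (by fun_prop)]
      simp only [sub_self, norm_zero, integral_zero, mul_zero, zero_add, sub_zero]
      have h1 : ∫ p, ‖p.1 - p.2‖ ∂(ρ.prod ν) ≤ D := by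
        have h2 : ∀ᵐ p ∂(ρ.prod ν), ‖p.1 - p.2‖ ≤ D := by
          filter_upwards [ae_prod_of_mem_couplings (prod_mem_couplings ρ ν) (mem_ae_iff.2 hρ)
            (mem_ae_iff.2 hν.2.1)] with p hp using hD _ hp.1 _ hp.2
        simpa using integral_mono_ae i2 (integrable_const D) h2
      have h0 : 0 ≤ ∫ p, ‖p.1 - p.2‖ ∂(ρ.prod ν) := integral_nonneg fun p => norm_nonneg _
      rw [mul_pow, Real.norm_eq_abs, sq_abs, mul_assoc, mul_comm (s ^ 2)]
      gcongr
  have := hgrad.hasFDerivWithinAt.hasDerivWithinAt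
  simpa using this

/-- The integral of a first variation against a Dirac mass recovers its values, so that first
variations are unique up to constants. -/
lemma IsFirstVariation.sub_eq_sub {F : Measure (Euc d) → ℝ} {f g : Euc d → ℝ}
    (hf : IsFirstVariation C F ρ f) (hg : IsFirstVariation C F ρ g) {x : Euc d} (hx : x ∈ C) :
    f x - ∫ y, f y ∂ρ = g x - ∫ y, g y ∂ρ := by
  have hdir : Measure.dirac x ∈ P2 C := by
    refine ⟨inferInstance, by simp [hx], ?_⟩
    rw [lintegral_dirac]
    exact ENNReal.pow_lt_top enorm_lt_top
  have h1 := (hf.2 _ hdir).2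
  have h2 := (hg.2 _ hdir).2
  rw [integral_dirac] at h1 h2
  exact (uniqueDiffOn_Icc_zero_one 0 (by simp)).eq_deriv _ h1 h2

end FirstVariation

/-! ### From the coupling expansion to a Wasserstein gradient -/

section Coupling

variable {d : ℕ} {C : Set (Euc d)} {D : ℝ} {ρ ν : Measure (Euc d)} {ξ : Euc d → Euc d}

lemma aestronglyMeasurable_inner_sub {γ : Measure (Euc d × Euc d)} (hγ : γ.map Prod.fst = ρ)
    (hξ : AEStronglyMeasurable ξ ρ) :
    AEStronglyMeasurable (fun p : Euc d × Euc d => (inner ℝ (ξ p.1) (p.2 - p.1) : ℝ)) γ := by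
  have h1 : AEStronglyMeasurable (fun p : Euc d × Euc d => ξ p.1) γ := by
    rw [← hγ] at hξ
    exact hξ.comp_measurable measurable_fst
  exact h1.inner (by fun_prop)

/-- An expansion in terms of the first variation gives one in terms of its gradient. -/
lemma abs_sub_integral_inner_le (hC : Convex ℝ C) (hb : Bornology.IsBounded C)
    (hD : ∀ x ∈ C, ∀ y ∈ C, ‖x - y‖ ≤ D) [IsProbabilityMeasure ρ] [IsProbabilityMeasure ν]
    (hρ : ρ Cᶜ = 0) (hν : ν Cᶜ = 0) {f : Euc d → ℝ} {L : ℝ} (hf : C11On C f ξ L)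
    {Δ c : ℝ} (hc : 0 ≤ c) {γ : Measure (Euc d × Euc d)} (hγ : γ ∈ couplings ρ ν)
    (hexp : |Δ - (∫ x, f x ∂ν - ∫ x, f x ∂ρ)| ≤ c * (∫ p, ‖p.1 - p.2‖ ∂γ) ^ 2) :
    |Δ - ∫ p, inner ℝ (ξ p.1) (p.2 - p.1) ∂γ| ≤ (c + L) * ∫ p, ‖p.1 - p.2‖ ^ 2 ∂γ := by
  have := isProbabilityMeasure_of_mem_couplings hγ
  have hae := ae_prod_of_mem_couplings hγ (mem_ae_iff.2 hρ) (mem_ae_iff.2 hν)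
  have i1 := integrable_norm_sub_of_mem_couplings hD hρ hν hγ 1
  simp only [pow_one] at i1
  have i2 := integrable_norm_sub_of_mem_couplings hD hρ hν hγ 2
  -- Nonnegativity of the variance of the displacement length.
  have hsq : (∫ p, ‖p.1 - p.2‖ ∂γ) ^ 2 ≤ ∫ p, ‖p.1 - p.2‖ ^ 2 ∂γ := by
    obtain ⟨e, he⟩ : ∃ e, e = ∫ p, ‖p.1 - p.2‖ ∂γ := ⟨_, rfl⟩
    have h0 : 0 ≤ ∫ p, (‖p.1 - p.2‖ ^ 2 - 2 * e * ‖p.1 - p.2‖ + e ^ 2) ∂γ :=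
      integral_nonneg fun p => by
        have := sq_nonneg (‖p.1 - p.2‖ - e)
        simp only [Pi.zero_apply]
        linarith
    have i3 : Integrable (fun p : Euc d × Euc d => ‖p.1 - p.2‖ ^ 2 - 2 * e * ‖p.1 - p.2‖) γ :=
      i2.sub (i1.const_mul _)
    rw [integral_add i3 (integrable_const _), integral_sub i2 (i1.const_mul _),
      integral_const_mul, ← he] at h0
    simp only [integral_const, probReal_univ, smul_eq_mul, one_mul] at h0
    rw [← he]
    linarith
  have jf1 := hf.integrable hC hb hρ
  have jf2 := hf.integrable hC hb hν
  have hm1 : MeasurePreserving Prod.fst γ ρ := ⟨measurable_fst, hγ.1⟩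
  have hm2 : MeasurePreserving Prod.snd γ ν := ⟨measurable_snd, hγ.2⟩
  have j1 : Integrable (fun p : Euc d × Euc d => f p.1) γ := hm1.integrable_comp_of_integrable jf1
  have j2 : Integrable (fun p : Euc d × Euc d => f p.2) γ := hm2.integrable_comp_of_integrable jf2
  have e1 : ∫ x, f x ∂ρ = ∫ p, f p.1 ∂γ := by
    have := integral_map (μ := γ) measurable_fst.aemeasurable (hγ.1 ▸ jf1.aestronglyMeasurable)
    rwa [hγ.1] at this
  have e2 : ∫ x, f x ∂ν = ∫ p, f p.2 ∂γ := by
    have := integral_map (μ := γ) measurable_snd.aemeasurable (hγ.2 ▸ jf2.aestronglyMeasurable)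
    rwa [hγ.2] at this
  obtain ⟨B, hB0, hB⟩ := hf.exists_norm_le hb
  have j3 : Integrable (fun p : Euc d × Euc d => (inner ℝ (ξ p.1) (p.2 - p.1) : ℝ)) γ := by
    refine Integrable.of_bound (C := B * D) (aestronglyMeasurable_inner_sub hγ.1
      (aestronglyMeasurable_of_continuousOn hρ hf.continuousOn_grad)) ?_
    filter_upwards [hae] with p hp
    exact (norm_inner_le_norm _ _).trans
      (mul_le_mul (hB _ hp.1) (hD _ hp.2 _ hp.1) (norm_nonneg _) hB0)
  have j4 : Integrable (fun p : Euc d × Euc d => f p.2 - f p.1) γ := j2.sub j1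
  have hquad : |(∫ x, f x ∂ν - ∫ x, f x ∂ρ) - ∫ p, inner ℝ (ξ p.1) (p.2 - p.1) ∂γ| ≤
      L * ∫ p, ‖p.1 - p.2‖ ^ 2 ∂γ := by
    rw [e1, e2, ← integral_sub j2 j1, ← integral_sub j4 j3, ← integral_const_mul,
      ← Real.norm_eq_abs]
    refine norm_integral_le_of_norm_le (i2.const_mul L) ?_
    filter_upwards [hae] with p hp
    rw [norm_sub_rev p.1]
    exact hf.quadratic hC hp.1 hp.2
  calc |Δ - ∫ p, inner ℝ (ξ p.1) (p.2 - p.1) ∂γ|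
      ≤ |Δ - (∫ x, f x ∂ν - ∫ x, f x ∂ρ)| +
        |(∫ x, f x ∂ν - ∫ x, f x ∂ρ) - ∫ p, inner ℝ (ξ p.1) (p.2 - p.1) ∂γ| :=
        abs_sub_le _ _ _
    _ ≤ c * ∫ p, ‖p.1 - p.2‖ ^ 2 ∂γ + L * ∫ p, ‖p.1 - p.2‖ ^ 2 ∂γ :=
        add_le_add (hexp.trans (by gcongr)) hquad
    _ = _ := by ring

/-- A coupling expansion with quadratic remainder yields a Wasserstein gradient. -/
lemma isWassersteinGradient_of_expansion (hb : Bornology.IsBounded C)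
    [IsProbabilityMeasure ρ] (hρ : ρ Cᶜ = 0) {F : Measure (Euc d) → ℝ} (hξ : MemLp ξ 2 ρ)
    {c : ℝ} (hc : 0 ≤ c)
    (hexp : ∀ ν : Measure (Euc d), IsProbabilityMeasure ν → ν Cᶜ = 0 → ∀ γ ∈ couplings ρ ν,
      |F ν - F ρ - ∫ p, inner ℝ (ξ p.1) (p.2 - p.1) ∂γ| ≤ c * ∫ p, ‖p.1 - p.2‖ ^ 2 ∂γ) :
    IsWassersteinGradient C F ρ ξ := by
  obtain ⟨R, hR⟩ := hb.exists_norm_le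
  have hex : ∀ ν : Measure (Euc d), ∃ γ, ν ∈ P2 C → γ ∈ optimalPlans ρ ν := fun ν => by
    by_cases hν : ν ∈ P2 C
    · have := hν.1
      obtain ⟨γ, hγ⟩ := optimalPlans_nonempty (μ := ρ) (ν := ν) (R := R)
        (by filter_upwards [mem_ae_iff.2 hρ] with x hx using hR x hx)
        (by filter_upwards [mem_ae_iff.2 hν.2.1] with x hx using hR x hx)
      exact ⟨γ, fun _ => hγ⟩
    · exact ⟨0, fun h => absurd h hν⟩
  choose plan hplan using hex
  -- With `W2 < η / (c + 1)`, the error `c * W2 ^ 2` is at most `η * W2`.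
  refine ⟨hξ, plan, fun ν hν => hplan ν hν, fun η hη => ⟨η / (c + 1), by positivity,
    fun ν hν hW => ?_⟩⟩
  have hγ := hplan ν hν
  have h1 := hexp ν hν.1 hν.2.1 _ hγ.1
  rw [← W2_sq_of_mem_optimalPlans hγ] at h1
  have hW0 : 0 ≤ W2 ρ ν := ENNReal.toReal_nonneg
  rw [lt_div_iff₀ (by positivity)] at hW
  refine h1.trans ?_
  nlinarith

end Coupling

/-! ### The Lions lift -/

section Lift

variable {d : ℕ} {C : Set (Euc d)} {ρ : Measure (Euc d)} {ξ : Euc d → Euc d}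
  {Z : Type*} [MeasurableSpace Z] {P : Measure Z}

lemma norm_sq_eq_integral {E : Type*} [NormedAddCommGroup E] [InnerProductSpace ℝ E]
    (V : Lp E 2 P) : ‖V‖ ^ 2 = ∫ z, ‖V z‖ ^ 2 ∂P := by
  rw [← real_inner_self_eq_norm_sq, L2.inner_def]
  simp

/-- A coupling expansion with quadratic remainder yields an L-derivative. -/
lemma isLDerivative_of_expansion [TopologicalSpace Z] [PolishSpace Z] [BorelSpace Z]
    [IsProbabilityMeasure P] {F : Measure (Euc d) → ℝ} (hξ : MemLp ξ 2 ρ) {c : ℝ}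
    (hexp : ∀ ν : Measure (Euc d), IsProbabilityMeasure ν → ν Cᶜ = 0 → ∀ γ ∈ couplings ρ ν,
      |F ν - F ρ - ∫ p, inner ℝ (ξ p.1) (p.2 - p.1) ∂γ| ≤ c * ∫ p, ‖p.1 - p.2‖ ^ 2 ∂γ) :
    IsLDerivative P C F ρ ξ := by
  refine ⟨hξ, fun X hX hXρ => ?_⟩
  have hXm : Measurable X := (Lp.stronglyMeasurable X).measurable
  have hG : MemLp (ξ ∘ X) 2 P := MemLp.comp_of_map (by rwa [hXρ]) hXm.aemeasurable
  refine ⟨hG.toLp, hG.coeFn_toLp, hasGradientWithinAt_of_quadratic (L := c) hX fun Y hY => ?_⟩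
  have hYm : Measurable Y := (Lp.stronglyMeasurable Y).measurable
  -- The joint law of `X` and `Y` is in general not optimal, so the expansion has to hold for
  -- arbitrary couplings.
  have hγ := map_prodMk_mem_couplings P hXm hYm
  rw [hXρ] at hγ
  have h := hexp _ (Measure.isProbabilityMeasure_map hYm.aemeasurable)
    (map_compl_eq_zero_of_ae_mem P hYm hY) _ hγ
  rw [integral_map (hXm.prodMk hYm).aemeasurable
    (aestronglyMeasurable_inner_sub hγ.1 hξ.aestronglyMeasurable),
    integral_map (hXm.prodMk hYm).aemeasurable (by fun_prop)] at h
  have e1 : inner ℝ hG.toLp (Y - X) = ∫ z, inner ℝ (ξ (X z)) (Y z - X z) ∂P := by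
    rw [L2.inner_def]
    refine integral_congr_ae ?_
    filter_upwards [hG.coeFn_toLp, Lp.coeFn_sub Y X] with z h1 h2
    rw [h1, h2]
    rfl
  have e2 : ‖Y - X‖ ^ 2 = ∫ z, ‖X z - Y z‖ ^ 2 ∂P := by
    rw [norm_sq_eq_integral]
    refine integral_congr_ae ?_
    filter_upwards [Lp.coeFn_sub Y X] with z h2
    rw [h2, norm_sub_rev]
    rfl
  rw [e1, e2, lift, lift, hXρ]
  exact h

lemma toLp_mem_L2In {X : Z → Euc d} (hX : MemLp X 2 P) (hXC : ∀ᵐ z ∂P, X z ∈ C) :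
    hX.toLp ∈ L2In P C := by
  filter_upwards [hXC, hX.coeFn_toLp] with z h1 h2
  rw [← h2] at h1
  exact h1

/-- On an atomless space, every law on a bounded set is the law of an `L²` random variable. -/
lemma exists_mem_L2In_map_eq [StandardBorelSpace Z] [IsProbabilityMeasure P]
    [NullSingletonClass P] [IsProbabilityMeasure ρ] (hb : Bornology.IsBounded C)
    (hρ : ρ Cᶜ = 0) : ∃ X ∈ L2In P C, P.map X = ρ := by
  obtain ⟨R, hR⟩ := hb.exists_norm_le
  obtain ⟨X, hX, hXρ⟩ := exists_measurable_map_eq_of_nullSingleton P ρ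
  have hXC : ∀ᵐ z ∂P, X z ∈ C := by
    rw [← hXρ] at hρ
    exact ae_of_ae_map hX.aemeasurable (mem_ae_iff.2 hρ)
  have hL : MemLp X 2 P := MemLp.of_bound hX.aestronglyMeasurable R
    (hXC.mono fun z hz => hR _ hz)
  exact ⟨hL.toLp, toLp_mem_L2In hL hXC, by rw [Measure.map_congr hL.coeFn_toLp, hXρ]⟩

lemma convex_L2In (hC : Convex ℝ C) : Convex ℝ (L2In P C) := by
  intro X hX Y hY a b ha hb hab
  change ∀ᵐ z ∂P, (a • X + b • Y) z ∈ C
  filter_upwards [hX, hY, Lp.coeFn_add (a • X) (b • Y), Lp.coeFn_smul a X, Lp.coeFn_smul b Y]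
    with z h1 h2 h3 h4 h5
  rw [h3, Pi.add_apply, h4, h5]
  exact hC h1 h2 ha hb hab

/-- Gradients relative to `L²(P; C)` are unique when `C` is convex with nonempty interior. -/
lemma ae_eq_of_hasGradientWithinAt_L2In [IsFiniteMeasure P] (hC : Convex ℝ C)
    (hint : (interior C).Nonempty) {Φ : Lp (Euc d) 2 P → ℝ} {X G G' : Lp (Euc d) 2 P}
    (hX : X ∈ L2In P C) (hG : HasGradientWithinAt Φ G (L2In P C) X)
    (hG' : HasGradientWithinAt Φ G' (L2In P C) X) : G = G' := by
  obtain ⟨x₀, hx₀⟩ := hint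
  obtain ⟨r, hr, hball⟩ := Metric.isOpen_iff.1 isOpen_interior x₀ hx₀
  set V := G - G' with hV
  have hVm : Measurable V := (Lp.stronglyMeasurable V).measurable
  -- By convexity `Y - X` is a tangent direction of `L2In P C` at `X`, and relative derivatives
  -- agree on such directions.
  have hort : ∀ Y ∈ L2In P C, inner ℝ V (Y - X) = 0 := fun Y hY => by
    have := hG.hasFDerivWithinAt.unique_on hG'.hasFDerivWithinAt
      (mem_tangentConeAt_of_segment_subset ((convex_L2In hC).segment_subset hX hY))
    simp only [InnerProductSpace.toDual_apply_apply] at this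
    rw [hV, inner_sub_left, this, sub_self]
  -- A perturbation of the constant `x₀` along `V`, rescaled to stay in the ball of radius `r`
  -- inside `C`. Pairing `V` with `y - x₀` gives the integral of `r ‖V‖² / (1 + ‖V‖)`, whose
  -- vanishing forces `V = 0`.
  let y : Z → Euc d := fun z => x₀ + (r / (1 + ‖V z‖)) • V z
  have hyb : ∀ z, ‖(r / (1 + ‖V z‖)) • V z‖ < r := fun z => by
    have := norm_nonneg (V z)
    rw [norm_smul, Real.norm_eq_abs, abs_of_pos (by positivity), div_mul_eq_mul_div,
      div_lt_iff₀ (by positivity)]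
    nlinarith
  have hyC : ∀ z, y z ∈ C := fun z => interior_subset (hball (by simpa [y] using hyb z))
  have hy : MemLp y 2 P := by
    refine MemLp.of_bound (Measurable.aestronglyMeasurable (by fun_prop)) (‖x₀‖ + r)
      (ae_of_all _ fun z => (norm_add_le _ _).trans ?_)
    have := hyb z
    gcongr
  have hc : MemLp (fun _ : Z => x₀) 2 P := memLp_const x₀
  have h1 := hort hy.toLp (toLp_mem_L2In hy (ae_of_all _ hyC))
  have h2 := hort hc.toLp (toLp_mem_L2In hc (ae_of_all _ fun _ => interior_subset hx₀))
  have h3 : inner ℝ V (hy.toLp - hc.toLp) = 0 := by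
    rw [← sub_sub_sub_cancel_right _ _ X, inner_sub_right, h1, h2, sub_self]
  have h4 : ∀ᵐ z ∂P, inner ℝ (V z) ((hy.toLp - hc.toLp) z) = r / (1 + ‖V z‖) * ‖V z‖ ^ 2 := by
    filter_upwards [hy.coeFn_toLp, hc.coeFn_toLp, Lp.coeFn_sub hy.toLp hc.toLp] with z e1 e2 e3
    rw [e3, Pi.sub_apply, e1, e2]
    simp only [y, add_sub_cancel_left]
    rw [inner_smul_right, real_inner_self_eq_norm_sq]
  have h5 : Integrable (fun z => r / (1 + ‖V z‖) * ‖V z‖ ^ 2) P :=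
    (L2.integrable_inner V (hy.toLp - hc.toLp)).congr h4
  rw [L2.inner_def, integral_congr_ae h4,
    integral_eq_zero_iff_of_nonneg (fun z => by positivity) h5] at h3
  have hV0 : V = 0 := by
    rw [Lp.eq_zero_iff_ae_eq_zero]
    filter_upwards [h3] with z hz
    have hpos : 0 < r / (1 + ‖V z‖) := by positivity
    simp only [Pi.zero_apply, mul_eq_zero, hpos.ne', false_or] at hz
    exact norm_eq_zero.1 (pow_eq_zero_iff two_ne_zero |>.1 hz)
  exact sub_eq_zero.1 hV0

/-- L-derivatives are unique. -/
lemma IsLDerivative.ae_eq [IsFiniteMeasure P] (hC : Convex ℝ C)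
    (hint : (interior C).Nonempty) {F : Measure (Euc d) → ℝ} {ζ : Euc d → Euc d}
    (hex : ∃ X ∈ L2In P C, P.map X = ρ)
    (hξ : IsLDerivative P C F ρ ξ) (hζ : IsLDerivative P C F ρ ζ) : ζ =ᵐ[ρ] ξ := by
  obtain ⟨X, hX, hXρ⟩ := hex
  obtain ⟨G, hGξ, hG⟩ := hξ.2 X hX hXρ
  obtain ⟨G', hGζ, hG'⟩ := hζ.2 X hX hXρ
  have hGG := ae_eq_of_hasGradientWithinAt_L2In hC hint hX hG hG'
  have hXm : Measurable X := (Lp.stronglyMeasurable X).measurable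
  have mξ := hξ.1.aestronglyMeasurable
  have mζ := hζ.1.aestronglyMeasurable
  rw [← hXρ] at mξ mζ ⊢
  have h1 := ae_of_ae_map hXm.aemeasurable mξ.ae_eq_mk
  have h2 := ae_of_ae_map hXm.aemeasurable mζ.ae_eq_mk
  -- Measurable representatives are needed to carry an almost sure identity under `P` over to the
  -- law of `X`.
  have h3 : mζ.mk ζ =ᵐ[P.map X] mξ.mk ξ := by
    refine (ae_map_iff hXm.aemeasurable (measurableSet_eq_fun
      mζ.stronglyMeasurable_mk.measurable mξ.stronglyMeasurable_mk.measurable)).2 ?_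
    filter_upwards [h1, h2, hGξ, hGζ] with z e1 e2 e3 e4
    rw [← e1, ← e2, ← e3, ← e4, hGG]
  exact mζ.ae_eq_mk.trans (h3.trans mξ.ae_eq_mk.symm)

end Lift


/-! ### Gradients of smooth functions and the tangent space -/

section Tangent

variable {d : ℕ} {C : Set (Euc d)} {f : Euc d → ℝ} {ξ : Euc d → Euc d} {L : ℝ}

/-- Mean value inequality on `C ∩ closedBall x R`, where the gradient is within `L * R` of its value
at `x`. Neither endpoint has to be `x`, so it applies to shifted points under a mollifier. -/
lemma C11On.abs_sub_sub_inner_le (hf : C11On C f ξ L) (hC : Convex ℝ C) {R : ℝ}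
    {x p q : Euc d} (hx : x ∈ C) (hp : p ∈ C) (hq : q ∈ C)
    (hpx : ‖p - x‖ ≤ R) (hqx : ‖q - x‖ ≤ R) :
    |f p - f q - inner ℝ (ξ x) (p - q)| ≤ L * R * ‖p - q‖ := by
  have h := (hC.inter (convex_closedBall x R)).norm_image_sub_le_of_norm_hasFDerivWithin_le'
    (𝕜 := ℝ) (f := f) (f' := fun z => InnerProductSpace.toDual ℝ (Euc d) (ξ z))
    (φ := InnerProductSpace.toDual ℝ (Euc d) (ξ x)) (C := L * R)
    (fun z hz => ((hf.hasGradient z hz.1).hasFDerivWithinAt).mono inter_subset_left)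
    (fun z hz => by
      rw [← map_sub, LinearIsometryEquiv.norm_map]
      refine (hf.lip z hz.1 x hx).trans ?_
      have := hf.nonneg
      have h2 : ‖z - x‖ ≤ R := by simpa [dist_eq_norm] using hz.2
      gcongr)
    (x := q) (y := p) ⟨hq, by simpa [dist_eq_norm] using hqx⟩
    ⟨hp, by simpa [dist_eq_norm] using hpx⟩
  simpa using h

/-- A function with Lipschitz gradient on a bounded convex body is approximated, together with
its gradient, by smooth functions on the whole space. -/
lemma C11On.exists_contDiff_gradient_approx (hf : C11On C f ξ L) (hC : Convex ℝ C)
    (hb : Bornology.IsBounded C) (hint : (interior C).Nonempty) {η : ℝ} (hη : 0 < η) :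
    ∃ φ : Euc d → ℝ, ContDiff ℝ (⊤ : ℕ∞) φ ∧ ∀ x ∈ C, ‖gradient φ x - ξ x‖ ≤ η := by
  obtain ⟨x₀, hx₀⟩ := hint
  obtain ⟨r, hr, hball⟩ := Metric.isOpen_iff.1 isOpen_interior x₀ hx₀
  have hL := hf.nonneg
  obtain ⟨B, hB0, hB⟩ := hf.exists_norm_le hb
  obtain ⟨D, hD⟩ := Metric.isBounded_iff.1 hb
  have hD0 : 0 ≤ D := dist_nonneg.trans (hD (interior_subset hx₀) (interior_subset hx₀))
  -- The extension only makes the convolution meaningful on all of `ℝᵈ`; near points of `C` the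
  -- construction reads `F` on `C` alone.
  obtain ⟨F, hFlip, hFf⟩ := LipschitzOnWith.extend_real (f := f) (s := C) (K := ⟨B, hB0⟩)
    (LipschitzOnWith.of_dist_le_mul fun x hx y hy => by
      rw [dist_eq_norm, dist_eq_norm]
      exact C11On.lipschitz hC hf.hasGradient hB hy hx)
  have hF : Continuous F := hFlip.continuous
  obtain ⟨s, hs0, hs1, hsη⟩ : ∃ s, 0 < s ∧ s < 1 ∧ L * (s * (D + r)) ≤ η := by
    refine ⟨min (1 / 2) (η / (L * (D + r) + 1)), by positivity, by
      exact (min_le_left _ _).trans_lt (by norm_num), ?_⟩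
    calc L * (min (1 / 2) (η / (L * (D + r) + 1)) * (D + r))
        ≤ L * (η / (L * (D + r) + 1) * (D + r)) := by gcongr; exact min_le_right _ _
      _ = η * ((L * (D + r)) / (L * (D + r) + 1)) := by ring
      _ ≤ η * 1 := by
        gcongr
        rw [div_le_one (by positivity)]
        linarith
      _ = η := mul_one η
  set t := 1 - s with ht
  have ht0 : 0 < t := by linarith
  have ht1 : t < 1 := by linarith
  -- Outer radius `s * r / 2`: the mollifier's shift and the variation of `y` around `x` together
  -- stay below `s * r`, the room gained by contracting.
  let ψ : ContDiffBump (0 : Euc d) := ⟨s * r / 4, s * r / 2, by positivity, by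
    have : 0 < s * r := by positivity
    linarith⟩
  let Ψ : Euc d → ℝ := ψ.normed volume
  have hΨc : HasCompactSupport Ψ := ψ.hasCompactSupport_normed
  have hΨcont : Continuous Ψ := ψ.continuous_normed
  let Φ : Euc d → ℝ := convolution Ψ F (ContinuousLinearMap.lsmul ℝ ℝ) volume
  have hΦ : ContDiff ℝ (⊤ : ℕ∞) Φ :=
    hΨc.contDiff_convolution_left _ ψ.contDiff_normed hF.locallyIntegrable
  have hΦdef : ∀ u, Φ u = ∫ z, Ψ z * F (u - z) := fun u => rfl
  have hΨi : Integrable Ψ := ψ.integrable_normed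
  have hΦi : ∀ u, Integrable (fun z => Ψ z * F (u - z)) := fun u =>
    (hΨcont.mul (by fun_prop)).integrable_of_hasCompactSupport hΨc.mul_right
  -- Contract towards `x₀` by the factor `t = 1 - s`, then mollify; `t⁻¹` undoes the chain-rule
  -- factor.
  let φ : Euc d → ℝ := fun y => t⁻¹ * Φ (t • y + s • x₀)
  have hφ : ContDiff ℝ (⊤ : ℕ∞) φ := contDiff_const.mul (hΦ.comp (by fun_prop))
  refine ⟨φ, hφ, fun x hx => ?_⟩
  -- The shifted point is `t • x + s • w` with `w` in the ball around `x₀`, hence in `C` by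
  -- convexity.
  have hmem : ∀ y z : Euc d, ‖y - x‖ < s * r / 2 → ‖z‖ < s * r / 2 →
      t • y + s • x₀ - z ∈ C ∧ ‖t • y + s • x₀ - z - x‖ ≤ s * (D + r) := by
    intro y z hy hz
    have hty : ‖t • (y - x)‖ < s * r / 2 := by
      rw [norm_smul, Real.norm_eq_abs, abs_of_pos ht0]
      nlinarith [norm_nonneg (y - x)]
    have hw : ‖t • (y - x) - z‖ < s * r := (norm_sub_le _ _).trans_lt (by linarith)
    constructor
    · have e : t • y + s • x₀ - z = t • x + s • (x₀ + s⁻¹ • (t • (y - x) - z)) := by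
        rw [smul_add, smul_inv_smul₀ hs0.ne', smul_sub]
        abel
      rw [e]
      refine hC hx (interior_subset (hball ?_)) ht0.le hs0.le (by rw [ht]; ring)
      rw [Metric.mem_ball, dist_eq_norm, add_sub_cancel_left, norm_smul, norm_inv,
        Real.norm_eq_abs, abs_of_pos hs0, inv_mul_eq_div, div_lt_iff₀ hs0]
      linarith
    · have e : t • y + s • x₀ - z - x = (t • (y - x) - z) + s • (x₀ - x) := by
        rw [ht]
        module
      rw [e]
      refine (norm_add_le _ _).trans ?_
      have h2 : ‖s • (x₀ - x)‖ ≤ s * D := by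
        rw [norm_smul, Real.norm_eq_abs, abs_of_pos hs0, ← dist_eq_norm]
        exact mul_le_mul_of_nonneg_left (hD (interior_subset hx₀) hx) hs0.le
      linarith
  have hdiff : HasFDerivAt (fun y => φ y - inner ℝ (ξ x) y)
      (fderiv ℝ φ x - InnerProductSpace.toDual ℝ (Euc d) (ξ x)) x :=
    ((hφ.differentiable (by simp)) x).hasFDerivAt.sub
      (InnerProductSpace.toDual ℝ (Euc d) (ξ x)).hasFDerivAt
  -- It suffices to bound the increments of `φ - ⟨ξ x, ·⟩` by `η * ‖y - x‖` near `x`. No formula for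
  -- the derivative of the convolution is used.
  have hnorm : ‖fderiv ℝ φ x - InnerProductSpace.toDual ℝ (Euc d) (ξ x)‖ ≤ η := by
    refine hdiff.le_of_lip' hη.le ?_
    have hnhds : Metric.ball x (s * r / 2) ∈ 𝓝 x := Metric.ball_mem_nhds _ (by positivity)
    filter_upwards [hnhds] with y hy
    rw [Metric.mem_ball, dist_eq_norm] at hy
    have e : φ y - inner ℝ (ξ x) y - (φ x - inner ℝ (ξ x) x) =
        ∫ z, Ψ z * (t⁻¹ * (F (t • y + s • x₀ - z) - F (t • x + s • x₀ - z) -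
          inner ℝ (ξ x) (t • (y - x)))) := by
      have h1 : ∀ z, Ψ z * (t⁻¹ * (F (t • y + s • x₀ - z) - F (t • x + s • x₀ - z) -
          inner ℝ (ξ x) (t • (y - x)))) =
          t⁻¹ * (Ψ z * F (t • y + s • x₀ - z) - Ψ z * F (t • x + s • x₀ - z)) -
            Ψ z * inner ℝ (ξ x) (y - x) := by
        intro z
        rw [inner_smul_right]
        field_simp
      have h2 : Integrable fun z =>
          t⁻¹ * (Ψ z * F (t • y + s • x₀ - z) - Ψ z * F (t • x + s • x₀ - z)) :=
        ((hΦi _).sub (hΦi _)).const_mul _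
      simp_rw [h1]
      rw [integral_sub h2 (hΨi.mul_const _),
        integral_const_mul, integral_sub (hΦi _) (hΦi _), integral_mul_const,
        show ∫ z, Ψ z = 1 from ψ.integral_normed, ← hΦdef, ← hΦdef]
      simp only [φ, inner_sub_right]
      ring
    rw [e]
    have hb : ∫ z, Ψ z * (η * ‖y - x‖) = η * ‖y - x‖ := by
      rw [integral_mul_const, show ∫ z, Ψ z = 1 from ψ.integral_normed, one_mul]
    rw [← hb]
    refine norm_integral_le_of_norm_le (hΨi.mul_const _) (ae_of_all _ fun z => ?_)
    rw [norm_mul, Real.norm_eq_abs, abs_of_nonneg (show 0 ≤ Ψ z from ψ.nonneg_normed z)]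
    by_cases hz : Ψ z = 0
    · simp [hz]
    have hz' : ‖z‖ < s * r / 2 := by
      have : z ∈ Function.support (ψ.normed volume) := hz
      rw [ψ.support_normed_eq] at this
      simpa [ψ] using this
    refine mul_le_mul_of_nonneg_left ?_ (ψ.nonneg_normed z)
    obtain ⟨hy1, hy2⟩ := hmem y z hy hz'
    obtain ⟨hx1, hx2⟩ := hmem x z (by rw [sub_self, norm_zero]; positivity) hz'
    have h := hf.abs_sub_sub_inner_le hC hx hy1 hx1 hy2 hx2
    have e2 : t • y + s • x₀ - z - (t • x + s • x₀ - z) = t • (y - x) := by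
      rw [smul_sub]; abel
    rw [e2, hFf hy1, hFf hx1, norm_smul, Real.norm_eq_abs, abs_of_pos ht0] at h
    rw [norm_mul, norm_inv, Real.norm_eq_abs, Real.norm_eq_abs, abs_of_pos ht0,
      inv_mul_le_iff₀ ht0]
    refine h.trans ?_
    calc L * (s * (D + r)) * (t * ‖y - x‖) ≤ η * (t * ‖y - x‖) := by gcongr
      _ = t * (η * ‖y - x‖) := by ring
  rw [gradient, ← LinearIsometryEquiv.norm_map (InnerProductSpace.toDual ℝ (Euc d)), map_sub,
    LinearIsometryEquiv.apply_symm_apply]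
  exact hnorm

lemma C11On.memLp {ρ : Measure (Euc d)} [IsFiniteMeasure ρ] (hf : C11On C f ξ L)
    (hb : Bornology.IsBounded C) (hρ : ρ Cᶜ = 0) : MemLp ξ 2 ρ := by
  obtain ⟨B, -, hB⟩ := hf.exists_norm_le hb
  refine MemLp.of_bound (aestronglyMeasurable_of_continuousOn hρ hf.continuousOn_grad) B ?_
  filter_upwards [mem_ae_iff.2 hρ] with x hx using hB x hx

/-- Lipschitz gradients on a bounded convex body are tangent vector fields. -/
lemma C11On.isTangent {ρ : Measure (Euc d)} [IsProbabilityMeasure ρ] (hf : C11On C f ξ L)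
    (hC : Convex ℝ C) (hb : Bornology.IsBounded C) (hint : (interior C).Nonempty)
    (hρ : ρ Cᶜ = 0) : IsTangent ρ ξ := by
  refine ⟨hf.memLp hb hρ, fun η hη => ?_⟩
  obtain ⟨η', hη', hlt⟩ := ENNReal.lt_iff_exists_nnreal_btwn.1 hη
  rw [ENNReal.coe_pos] at hη'
  obtain ⟨φ, hφ, hφξ⟩ := hf.exists_contDiff_gradient_approx hC hb hint (η := η') hη'
  obtain ⟨R, hR0, hR⟩ := hb.exists_pos_norm_le
  -- The cutoff is `1` near every point of `C`, so it leaves the gradient there unchanged.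
  let χ : ContDiffBump (0 : Euc d) := ⟨R + 1, R + 2, by linarith, by linarith⟩
  refine ⟨fun x => χ x * φ x, χ.contDiff.mul hφ, χ.hasCompactSupport.mul_right, ?_⟩
  refine lt_of_le_of_lt ?_ hlt
  have hae : ∀ᵐ x ∂ρ, ‖ξ x - gradient (fun x => χ x * φ x) x‖ ≤ η' := by
    filter_upwards [mem_ae_iff.2 hρ] with x hx
    have h1 : (fun x => χ x * φ x) =ᶠ[𝓝 x] φ := by
      have hxb : x ∈ Metric.ball (0 : Euc d) χ.rIn := by
        have := hR x hx
        simp only [Metric.mem_ball, dist_zero_right, χ]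
        linarith
      filter_upwards [χ.eventuallyEq_one_of_mem_ball hxb] with y hy
      rw [hy]; simp
    have h2 : gradient (fun x => χ x * φ x) x = gradient φ x := by
      rw [gradient, gradient, h1.fderiv_eq]
    rw [h2, norm_sub_rev]
    exact hφξ x hx
  have := eLpNorm_le_of_ae_bound (p := 2) hae
  simpa using this

end Tangent


/-! ### Uniqueness of the tangent Wasserstein gradient -/

section Uniqueness

variable {d : ℕ} {C : Set (Euc d)} {ρ : Measure (Euc d)} {ξ ζ : Euc d → Euc d}

/-- Along a displacement by a Lipschitz gradient field that points into `C`, optimal plans are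
unique, so all Wasserstein gradients have the same directional derivative. -/
lemma IsWassersteinGradient.integral_inner_eq (hb : Bornology.IsBounded C)
    [IsProbabilityMeasure ρ] (hρ : ρ Cᶜ = 0) {F : Measure (Euc d) → ℝ}
    (hξ : IsWassersteinGradient C F ρ ξ) (hζ : IsWassersteinGradient C F ρ ζ)
    {ψ : Euc d → ℝ} {v : Euc d → Euc d} {L : ℝ} (hψ : C11On univ ψ v L)
    (hv : ∀ s : ℝ, 0 < s → s ≤ 1 → ∀ x ∈ C, x + s • v x ∈ interior C) :
    ∫ x, inner ℝ (ξ x) (v x) ∂ρ = ∫ x, inner ℝ (ζ x) (v x) ∂ρ := by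
  obtain ⟨R, hR⟩ := hb.exists_norm_le
  have hL := hψ.nonneg
  have hψc : Continuous ψ := continuousOn_univ.1 hψ.continuousOn
  have hvc : Continuous v := continuousOn_univ.1 hψ.continuousOn_grad
  have hρR : ∀ᵐ x ∂ρ, ‖x‖ ≤ R := by
    filter_upwards [mem_ae_iff.2 hρ] with x hx using hR x hx
  obtain ⟨planξ, hplanξ, hFξ⟩ := hξ.2
  obtain ⟨planζ, hplanζ, hFζ⟩ := hζ.2
  obtain ⟨A, hA⟩ : ∃ A, A = √(∫ x, ‖v x‖ ^ 2 ∂ρ) := ⟨_, rfl⟩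
  have hA0 : 0 ≤ A := hA ▸ Real.sqrt_nonneg _
  have hA2 : A ^ 2 = ∫ x, ‖v x‖ ^ 2 ∂ρ := by
    rw [hA, Real.sq_sqrt (integral_nonneg fun x => by positivity)]
  -- the displaced measures
  have hdisp : ∀ s : ℝ, 0 < s → s ≤ 1 → s * (4 * L + 1) ≤ 1 → ∃ ν ∈ P2 C, W2 ρ ν = s * A ∧
      planξ ν = ρ.map (fun x => (x, x + s • v x)) ∧
      planζ ν = ρ.map (fun x => (x, x + s • v x)) := by
    intro s hs0 hs1 hsL
    have hT : Continuous fun x => x + s • v x := by fun_prop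
    have hTint : ∀ᵐ y ∂(ρ.map fun x => x + s • v x), y ∈ interior C := by
      refine (ae_map_iff hT.aemeasurable isOpen_interior.measurableSet).2 ?_
      filter_upwards [mem_ae_iff.2 hρ] with x hx using hv s hs0 hs1 x hx
    have hνp : IsProbabilityMeasure (ρ.map fun x => x + s • v x) :=
      Measure.isProbabilityMeasure_map hT.aemeasurable
    have hν : ρ.map (fun x => x + s • v x) ∈ P2 C := by
      refine ⟨hνp, mem_ae_iff.1 (hTint.mono fun y hy => interior_subset hy), ?_⟩
      refine lt_of_le_of_lt (lintegral_mono_ae (g := fun _ => ENNReal.ofReal R ^ 2) ?_) ?_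
      · filter_upwards [hTint] with y hy
        have := hR y (interior_subset hy)
        rw [← ofReal_norm]
        gcongr
      · simp
    have huniq : ∀ γ ∈ optimalPlans ρ (ρ.map fun x => x + s • v x),
        γ = ρ.map (fun x => (x, x + s • v x)) := by
      intro γ hγ
      -- With `q = 2sψ` the right-hand side is at least `(1 - 2sL) ‖x - y‖²`, and `4sL ≤ 1` makes
      -- the factor at least `1 / 2`.
      refine eq_map_of_mem_optimalPlans hρR hT (q := fun x => 2 * s * ψ x) (by fun_prop)
        (c := 1 / 2) (by norm_num) (fun x y => ?_) hγ
      have h1 := abs_le.1 (hψ.quadratic convex_univ (mem_univ y) (mem_univ x))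
      have h2 : ‖x - (y + s • v y)‖ ^ 2 = ‖x - y‖ ^ 2 - 2 * (s * inner ℝ (v y) (x - y)) +
          ‖s • v y‖ ^ 2 := by
        rw [← sub_sub, norm_sub_sq_real, inner_smul_right, real_inner_comm]
      have h3 : ‖y - (y + s • v y)‖ ^ 2 = ‖s • v y‖ ^ 2 := by
        rw [sub_add_cancel_left, norm_neg]
      rw [h2, h3]
      have h4 := mul_le_mul_of_nonneg_left h1.1 hs0.le
      have h5 : s * (4 * L) * ‖x - y‖ ^ 2 ≤ 1 * ‖x - y‖ ^ 2 := by
        gcongr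
        linarith
      nlinarith
    have hξν := huniq _ (hplanξ _ hν)
    refine ⟨_, hν, ?_, hξν, huniq _ (hplanζ _ hν)⟩
    have h1 := W2_sq_of_mem_optimalPlans (hplanξ _ hν)
    rw [hξν, integral_map (by fun_prop) (by fun_prop)] at h1
    have h2 : W2 ρ (ρ.map fun x => x + s • v x) ^ 2 = (s * A) ^ 2 := by
      rw [h1, mul_pow, hA2, ← integral_const_mul]
      refine integral_congr_ae (ae_of_all _ fun x => ?_)
      simp only [sub_add_cancel_left, norm_neg, norm_smul, mul_pow, Real.norm_eq_abs, sq_abs]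
    exact (pow_left_inj₀ ENNReal.toReal_nonneg (by positivity) two_ne_zero).1 h2
  have hint : ∀ {θ : Euc d → Euc d} (s : ℝ), MemLp θ 2 ρ →
      ∫ p, inner ℝ (θ p.1) (p.2 - p.1) ∂(ρ.map (fun x => (x, x + s • v x))) =
        s * ∫ x, inner ℝ (θ x) (v x) ∂ρ := by
    intro θ s hθ
    have hm : Measurable fun x => (x, x + s • v x) := Continuous.measurable (by fun_prop)
    rw [integral_map hm.aemeasurable (aestronglyMeasurable_inner_sub
      (by rw [Measure.map_map measurable_fst hm]; exact Measure.map_id) hθ.aestronglyMeasurable),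
      ← integral_const_mul]
    refine integral_congr_ae (ae_of_all _ fun x => ?_)
    simp only [add_sub_cancel_left, inner_smul_right]
  have hle : ∀ η : ℝ, 0 < η →
      |∫ x, inner ℝ (ξ x) (v x) ∂ρ - ∫ x, inner ℝ (ζ x) (v x) ∂ρ| ≤ 2 * A * η := by
    intro η hη
    obtain ⟨δ₁, hδ₁, h₁⟩ := hFξ η hη
    obtain ⟨δ₂, hδ₂, h₂⟩ := hFζ η hη
    obtain ⟨s, hs0, hs1, hsL, hsδ₁, hsδ₂⟩ : ∃ s : ℝ, 0 < s ∧ s ≤ 1 ∧ s * (4 * L + 1) ≤ 1 ∧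
        s * A < δ₁ ∧ s * A < δ₂ := by
      -- The first entry keeps the displacement uniquely optimal, the second brings `W2 = s * A`
      -- below both thresholds; `A + 1` covers `A = 0`.
      refine ⟨min (1 / (4 * L + 1)) (min δ₁ δ₂ / (A + 1)), by positivity, ?_, ?_, ?_⟩
      · refine (min_le_left _ _).trans ?_
        rw [div_le_one (by positivity)]
        linarith
      · rw [← le_div_iff₀ (by positivity)]
        exact min_le_left _ _
      · have hpos : 0 < min δ₁ δ₂ := lt_min hδ₁ hδ₂
        have : min (1 / (4 * L + 1)) (min δ₁ δ₂ / (A + 1)) * A < min δ₁ δ₂ := by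
          calc _ ≤ min δ₁ δ₂ / (A + 1) * A := by gcongr; exact min_le_right _ _
            _ = min δ₁ δ₂ * (A / (A + 1)) := by ring
            _ < min δ₁ δ₂ * 1 := by
              gcongr
              rw [div_lt_one (by positivity)]
              linarith
            _ = min δ₁ δ₂ := mul_one _
        exact lt_min_iff.1 this
    obtain ⟨ν, hν, hW, hp1, hp2⟩ := hdisp s hs0 hs1 hsL
    have g1 := h₁ ν hν (by rwa [hW])
    have g2 := h₂ ν hν (by rwa [hW])
    rw [hp1, hint s hξ.1, hW] at g1
    rw [hp2, hint s hζ.1, hW] at g2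
    have h3 : s * |∫ x, inner ℝ (ξ x) (v x) ∂ρ - ∫ x, inner ℝ (ζ x) (v x) ∂ρ| ≤
        s * (2 * A * η) := by
      rw [← abs_of_pos hs0, ← abs_mul, abs_of_pos hs0]
      rw [abs_le] at g1 g2 ⊢
      constructor <;> linarith [g1.1, g1.2, g2.1, g2.2]
    exact le_of_mul_le_mul_left h3 hs0
  have hzero : |∫ x, inner ℝ (ξ x) (v x) ∂ρ - ∫ x, inner ℝ (ζ x) (v x) ∂ρ| ≤ 0 := by
    refine le_of_forall_pos_le_add fun η hη => ?_
    refine (hle (η / (2 * A + 1)) (by positivity)).trans ?_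
    rw [zero_add, mul_div_assoc', div_le_iff₀ (by positivity)]
    nlinarith
  exact sub_eq_zero.1 (abs_nonpos_iff.1 hzero)

lemma integrable_inner_of_memLp {u w : Euc d → Euc d} (hu : MemLp u 2 ρ) (hw : MemLp w 2 ρ) :
    Integrable (fun x => (inner ℝ (u x) (w x) : ℝ)) ρ := by
  refine (L2.integrable_inner (𝕜 := ℝ) hu.toLp hw.toLp).congr ?_
  filter_upwards [hu.coeFn_toLp, hw.coeFn_toLp] with x h1 h2
  rw [h1, h2]

lemma continuous_gradient_of_contDiff {φ : Euc d → ℝ} (hφ : ContDiff ℝ (⊤ : ℕ∞) φ) :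
    Continuous (gradient φ) :=
  (InnerProductSpace.toDual ℝ (Euc d)).symm.continuous.comp (hφ.continuous_fderiv (by simp))

lemma exists_norm_gradient_le {φ : Euc d → ℝ} (hφ : ContDiff ℝ (⊤ : ℕ∞) φ)
    (hφc : HasCompactSupport φ) : ∃ B, ∀ x, ‖gradient φ x‖ ≤ B := by
  obtain ⟨B, hB⟩ := (hφc.fderiv ℝ).exists_bound_of_continuous (hφ.continuous_fderiv (by simp))
  exact ⟨B, fun x => by rw [gradient, LinearIsometryEquiv.norm_map]; exact hB x⟩

lemma exists_c11On_of_contDiff {φ : Euc d → ℝ} (hφ : ContDiff ℝ (⊤ : ℕ∞) φ)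
    (hφc : HasCompactSupport φ) : ∃ L, C11On univ φ (gradient φ) L := by
  obtain ⟨K, hK⟩ := ContDiff.lipschitzWith_of_hasCompactSupport (hφc.fderiv ℝ)
    (hφ.fderiv_right (m := 1) (by norm_cast)) one_ne_zero
  refine ⟨K, K.2, fun x _ => ?_, fun x _ y _ => ?_⟩
  · rw [hasGradientWithinAt_iff_hasFDerivWithinAt, gradient,
      LinearIsometryEquiv.apply_symm_apply]
    exact ((hφ.differentiable (by simp)) x).hasFDerivAt.hasFDerivWithinAt
  · rw [gradient, gradient, ← map_sub, LinearIsometryEquiv.norm_map]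
    exact hK.norm_sub_le x y

/-- The attraction towards a point is a Lipschitz gradient field. -/
lemma c11On_neg_half_norm_sub_sq (x₀ : Euc d) :
    C11On univ (fun x => -(‖x - x₀‖ ^ 2 / 2)) (fun x => x₀ - x) 1 := by
  refine C11On.of_quadratic zero_le_one (fun x _ y _ => ?_) fun x _ y _ => ?_
  · have h : ‖y - x₀‖ ^ 2 = ‖y - x‖ ^ 2 + 2 * inner ℝ (y - x) (x - x₀) + ‖x - x₀‖ ^ 2 := by
      rw [← norm_add_sq_real, sub_add_sub_cancel]
    have h2 : inner ℝ (x₀ - x) (y - x) = -inner ℝ (y - x) (x - x₀) := by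
      rw [← inner_neg_right, neg_sub, real_inner_comm]
    rw [h, h2, abs_le]
    constructor <;> nlinarith [sq_nonneg ‖y - x‖]
  · rw [sub_sub_sub_cancel_left, norm_sub_rev, one_mul]

lemma C11On.const_mul {f : Euc d → ℝ} {L : ℝ} (hf : C11On C f ξ L) {t : ℝ} (ht : 0 ≤ t) :
    C11On C (fun x => t * f x) (fun x => t • ξ x) (t * L) where
  nonneg := mul_nonneg ht hf.nonneg
  hasGradient x hx := by
    have := (hf.hasGradient x hx).hasFDerivWithinAt.const_mul t
    rw [hasGradientWithinAt_iff_hasFDerivWithinAt]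
    simpa using this
  lip x hx y hy := by
    rw [← smul_sub, norm_smul, Real.norm_eq_abs, abs_of_nonneg ht, mul_assoc]
    exact mul_le_mul_of_nonneg_left (hf.lip x hx y hy) ht

/-- Wasserstein gradients agree when tested against gradients of smooth functions. -/
lemma IsWassersteinGradient.integral_inner_gradient_eq (hC : Convex ℝ C)
    (hb : Bornology.IsBounded C) (hint : (interior C).Nonempty)
    [IsProbabilityMeasure ρ] (hρ : ρ Cᶜ = 0) {F : Measure (Euc d) → ℝ}
    (hξ : IsWassersteinGradient C F ρ ξ) (hζ : IsWassersteinGradient C F ρ ζ)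
    {φ : Euc d → ℝ} (hφ : ContDiff ℝ (⊤ : ℕ∞) φ) (hφc : HasCompactSupport φ) :
    ∫ x, inner ℝ (ξ x) (gradient φ x) ∂ρ = ∫ x, inner ℝ (ζ x) (gradient φ x) ∂ρ := by
  obtain ⟨x₀, hx₀⟩ := hint
  obtain ⟨r, hr, hball⟩ := Metric.isOpen_iff.1 isOpen_interior x₀ hx₀
  obtain ⟨B, hB⟩ := exists_norm_gradient_le hφ hφc
  have hB0 : 0 ≤ B := (norm_nonneg _).trans (hB 0)
  obtain ⟨K, hK⟩ := exists_c11On_of_contDiff hφ hφc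
  have hgc := continuous_gradient_of_contDiff hφ
  obtain ⟨R, hR⟩ := hb.exists_norm_le
  -- The bare field `∇φ` may leave `C`. Adding the attraction to `x₀` turns each displaced point
  -- into a convex combination of `x` and a point of the interior ball.
  have key : ∀ t, 0 ≤ t → t * B < r →
      ∫ x, inner ℝ (ξ x) ((x₀ - x) + t • gradient φ x) ∂ρ =
        ∫ x, inner ℝ (ζ x) ((x₀ - x) + t • gradient φ x) ∂ρ := by
    intro t ht htB
    refine hξ.integral_inner_eq hb hρ hζ
      ((c11On_neg_half_norm_sub_sq x₀).add (hK.const_mul ht)) fun s hs0 hs1 x hx => ?_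
    have e : x + s • ((x₀ - x) + t • gradient φ x) =
        (1 - s) • x + s • (x₀ + t • gradient φ x) := by module
    rw [e]
    refine hC.combo_self_interior_mem_interior hx (hball ?_) (by linarith) hs0 (by ring)
    rw [Metric.mem_ball, dist_eq_norm, add_sub_cancel_left, norm_smul, Real.norm_eq_abs,
      abs_of_nonneg ht]
    exact lt_of_le_of_lt (by have := hB x; gcongr) htB
  have hm1 : MemLp (fun x => x₀ - x) 2 ρ := by
    refine MemLp.of_bound (Continuous.aestronglyMeasurable (by fun_prop)) (‖x₀‖ + R) ?_
    filter_upwards [mem_ae_iff.2 hρ] with x hx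
    exact (norm_sub_le _ _).trans (by have := hR x hx; gcongr)
  have hm2 : MemLp (gradient φ) 2 ρ :=
    MemLp.of_bound hgc.aestronglyMeasurable B (ae_of_all _ hB)
  have hsplit : ∀ {θ : Euc d → Euc d}, MemLp θ 2 ρ → ∀ t : ℝ,
      ∫ x, inner ℝ (θ x) ((x₀ - x) + t • gradient φ x) ∂ρ =
        ∫ x, inner ℝ (θ x) (x₀ - x) ∂ρ + t * ∫ x, inner ℝ (θ x) (gradient φ x) ∂ρ := by
    intro θ hθ t
    have i1 : Integrable (fun x => (inner ℝ (θ x) (x₀ - x) : ℝ)) ρ := integrable_inner_of_memLp hθ hm1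
    have i2 : Integrable (fun x => (inner ℝ (θ x) (gradient φ x) : ℝ)) ρ :=
      integrable_inner_of_memLp hθ hm2
    simp_rw [inner_add_right, inner_smul_right]
    rw [integral_add i1 (i2.const_mul t), integral_const_mul]
  have ht : 0 < r / (B + 1) := by positivity
  -- Both sides are affine in `t`: the values at `0` and at one positive `t` isolate the pairing
  -- with `∇φ`.
  have k0 := key 0 le_rfl (by rwa [zero_mul])
  have k1 := key (r / (B + 1)) ht.le (by
    rw [div_mul_eq_mul_div, div_lt_iff₀ (by positivity)]
    nlinarith)
  rw [hsplit hξ.1, hsplit hζ.1] at k0 k1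
  simp only [zero_mul, add_zero] at k0
  rw [k0] at k1
  exact mul_left_cancel₀ ht.ne' (add_left_cancel k1)

/-- A field that is orthogonal to all gradients of smooth functions is orthogonal to the tangent
space. -/
lemma IsTangent.integral_inner_eq_zero [IsProbabilityMeasure ρ] {w θ : Euc d → Euc d}
    (hw : MemLp w 2 ρ)
    (h : ∀ φ : Euc d → ℝ, ContDiff ℝ (⊤ : ℕ∞) φ → HasCompactSupport φ →
      ∫ x, inner ℝ (w x) (gradient φ x) ∂ρ = 0) (hθ : IsTangent ρ θ) :
    ∫ x, inner ℝ (w x) (θ x) ∂ρ = 0 := by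
  have hbound : ∀ η : ℝ, 0 < η → |∫ x, inner ℝ (w x) (θ x) ∂ρ| ≤ ‖hw.toLp‖ * η := by
    intro η hη
    obtain ⟨φ, hφ, hφc, hlt⟩ := hθ.2 (ENNReal.ofReal η) (ENNReal.ofReal_pos.2 hη)
    obtain ⟨B, hB⟩ := exists_norm_gradient_le hφ hφc
    have hm : MemLp (gradient φ) 2 ρ := MemLp.of_bound
      (continuous_gradient_of_contDiff hφ).aestronglyMeasurable B (ae_of_all _ hB)
    have hd : MemLp (fun x => θ x - gradient φ x) 2 ρ := hθ.1.sub hm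
    have i1 : Integrable (fun x => (inner ℝ (w x) (θ x) : ℝ)) ρ := integrable_inner_of_memLp hw hθ.1
    have i2 : Integrable (fun x => (inner ℝ (w x) (gradient φ x) : ℝ)) ρ := integrable_inner_of_memLp hw hm
    have e : ∫ x, inner ℝ (w x) (θ x) ∂ρ = inner ℝ hw.toLp hd.toLp := by
      rw [L2.inner_def, ← sub_zero (∫ x, inner ℝ (w x) (θ x) ∂ρ), ← h φ hφ hφc,
        ← integral_sub i1 i2]
      refine integral_congr_ae ?_
      filter_upwards [hw.coeFn_toLp, hd.coeFn_toLp] with x h1 h2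
      rw [h1, h2, inner_sub_right]
    rw [e]
    refine (abs_real_inner_le_norm _ _).trans ?_
    gcongr
    rw [Lp.norm_toLp]
    exact ENNReal.toReal_le_of_le_ofReal hη.le hlt.le
  have hzero : |∫ x, inner ℝ (w x) (θ x) ∂ρ| ≤ 0 := by
    refine le_of_forall_pos_le_add fun η hη => ?_
    have hn := norm_nonneg hw.toLp
    refine (hbound (η / (‖hw.toLp‖ + 1)) (by positivity)).trans ?_
    rw [zero_add, mul_div_assoc', div_le_iff₀ (by positivity)]
    nlinarith
  exact abs_nonpos_iff.1 hzero

/-- Tangent Wasserstein gradients are unique. -/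
lemma IsWassersteinGradient.ae_eq_of_isTangent (hC : Convex ℝ C)
    (hb : Bornology.IsBounded C) (hint : (interior C).Nonempty)
    [IsProbabilityMeasure ρ] (hρ : ρ Cᶜ = 0) {F : Measure (Euc d) → ℝ}
    (hξ : IsWassersteinGradient C F ρ ξ) (hζ : IsWassersteinGradient C F ρ ζ)
    (hξt : IsTangent ρ ξ) (hζt : IsTangent ρ ζ) : ζ =ᵐ[ρ] ξ := by
  have hw : MemLp (fun x => ζ x - ξ x) 2 ρ := hζ.1.sub hξ.1
  have horth : ∀ φ : Euc d → ℝ, ContDiff ℝ (⊤ : ℕ∞) φ → HasCompactSupport φ →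
      ∫ x, inner ℝ (ζ x - ξ x) (gradient φ x) ∂ρ = 0 := by
    intro φ hφ hφc
    obtain ⟨B, hB⟩ := exists_norm_gradient_le hφ hφc
    have hm : MemLp (gradient φ) 2 ρ := MemLp.of_bound
      (continuous_gradient_of_contDiff hφ).aestronglyMeasurable B (ae_of_all _ hB)
    simp_rw [inner_sub_left]
    rw [integral_sub (integrable_inner_of_memLp hζ.1 hm) (integrable_inner_of_memLp hξ.1 hm),
      hξ.integral_inner_gradient_eq hC hb hint hρ hζ hφ hφc, sub_self]
  -- The difference is orthogonal to the tangent space, which contains both `ζ` and `ξ`.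
  have h0 : ∫ x, ‖ζ x - ξ x‖ ^ 2 ∂ρ = 0 := by
    simp_rw [← real_inner_self_eq_norm_sq, inner_sub_right (ζ _ - ξ _)]
    rw [integral_sub (integrable_inner_of_memLp hw hζ.1) (integrable_inner_of_memLp hw hξ.1),
      hζt.integral_inner_eq_zero hw horth, hξt.integral_inner_eq_zero hw horth, sub_self]
  have hi : Integrable (fun x => ‖ζ x - ξ x‖ ^ 2) ρ := hw.integrable_norm_pow two_ne_zero
  rw [integral_eq_zero_iff_of_nonneg (fun x => by positivity) hi] at h0
  filter_upwards [h0] with x hx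
  exact sub_eq_zero.1 (norm_eq_zero.1 (pow_eq_zero_iff two_ne_zero |>.1 hx))

end Uniqueness

end RegKL

/-! ### The main theorem -/

theorem mainTheorem2 {d : ℕ} (C : Set (RegKL.Euc d)) (hconv : Convex ℝ C)
    (hbdd : Bornology.IsBounded C) (hint : (interior C).Nonempty)
    (U : RegKL.Euc d → ℝ) (C₀ C₁ C₂ : ℝ) (hU : RegKL.PotentialAssumption C U C₀ C₁ C₂)
    (ε : ℝ) (hε : 0 < ε)
    {Z : Type*} [TopologicalSpace Z] [PolishSpace Z] [MeasurableSpace Z] [BorelSpace Z]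
    (P : Measure Z) [IsProbabilityMeasure P] [NullSingletonClass P]
    (ρ : Measure (RegKL.Euc d)) (hρ : ρ ∈ RegKL.P2 C) :
    -- the functional is well defined (finite) at `ρ`
    Integrable (fun x => U x + Real.log (RegKL.gaussConv ε ρ x)) ρ ∧
    -- a first variation exists
    (∃ f : RegKL.Euc d → ℝ, RegKL.IsFirstVariation C (RegKL.regKL U ε) ρ f) ∧
    -- the functional is L-differentiable
    RegKL.IsLDifferentiableAt P C (RegKL.regKL U ε) ρ ∧
    ∃ ξ : RegKL.Euc d → RegKL.Euc d,
      -- `ξ` is the gradient of the first variation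
      (∀ f : RegKL.Euc d → ℝ, RegKL.IsFirstVariation C (RegKL.regKL U ε) ρ f →
        ∀ x ∈ C, HasGradientWithinAt f (ξ x) C x) ∧
      -- `ξ` is the L-derivative
      RegKL.IsLDerivative P C (RegKL.regKL U ε) ρ ξ ∧
      (∀ ζ : RegKL.Euc d → RegKL.Euc d,
        RegKL.IsLDerivative P C (RegKL.regKL U ε) ρ ζ → ζ =ᵐ[ρ] ξ) ∧
      -- `ξ` is a Wasserstein gradient, and the only one in the tangent space at `ρ`
      RegKL.IsWassersteinGradient C (RegKL.regKL U ε) ρ ξ ∧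
      RegKL.IsTangent ρ ξ ∧
      (∀ ζ : RegKL.Euc d → RegKL.Euc d,
        RegKL.IsWassersteinGradient C (RegKL.regKL U ε) ρ ζ → RegKL.IsTangent ρ ζ →
          ζ =ᵐ[ρ] ξ) := by
  obtain ⟨gradU, hgradU, hlipU, -⟩ := hU
  -- `C₁` may be negative when `C` is a single point (`d = 0`), hence the absolute value.
  have hU' : RegKL.C11On C U gradU |C₁| := ⟨abs_nonneg _, hgradU, fun x hx y hy =>
    (hlipU x hx y hy).trans (by gcongr; exact le_abs_self _)⟩
  have hprob := hρ.1
  have hρC := hρ.2.1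
  obtain ⟨D, hDdist⟩ := Metric.isBounded_iff.1 hbdd
  have hD : ∀ x ∈ C, ∀ y ∈ C, ‖x - y‖ ≤ D := fun x hx y hy => by
    rw [← dist_eq_norm]; exact hDdist hx hy
  have hD0 : 0 ≤ D := by
    obtain ⟨x₀, hx₀⟩ := hint
    exact dist_nonneg.trans (hDdist (interior_subset hx₀) (interior_subset hx₀))
  obtain ⟨M, hf⟩ := RegKL.firstVar_c11On hε hconv hD hD0 hρC hU'
  obtain ⟨c, hc, hexp⟩ := RegKL.exists_regKL_expansion hε hconv hbdd hD hD0 hρC hU'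
  have hfv : RegKL.IsFirstVariation C (RegKL.regKL U ε) ρ (RegKL.firstVar U ε ρ) :=
    RegKL.isFirstVariation_of_expansion hD hρC
      (fun ν hν => by have := hν.1; exact hf.integrable hconv hbdd hν.2.1)
      (hf.integrable hconv hbdd hρC) hc hexp
  have hexp' : ∀ ν : Measure (RegKL.Euc d), IsProbabilityMeasure ν → ν Cᶜ = 0 →
      ∀ γ ∈ RegKL.couplings ρ ν, |RegKL.regKL U ε ν - RegKL.regKL U ε ρ -
        ∫ p, inner ℝ (RegKL.firstVarGrad gradU ε ρ p.1) (p.2 - p.1) ∂γ| ≤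
          (c + M) * ∫ p, ‖p.1 - p.2‖ ^ 2 ∂γ := fun ν _ hν γ hγ =>
    RegKL.abs_sub_integral_inner_le hconv hbdd hD hρC hν hf hc hγ (hexp ν inferInstance hν γ hγ)
  have hξ := hf.memLp hbdd hρC
  have hW := RegKL.isWassersteinGradient_of_expansion hbdd hρC hξ (add_nonneg hc hf.nonneg) hexp'
  have hL : RegKL.IsLDerivative P C (RegKL.regKL U ε) ρ (RegKL.firstVarGrad gradU ε ρ) :=
    RegKL.isLDerivative_of_expansion hξ hexp'
  have hX := RegKL.exists_mem_L2In_map_eq (P := P) hbdd hρC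
  have ht := hf.isTangent hconv hbdd hint hρC
  refine ⟨?_, ⟨_, hfv⟩, ?_, RegKL.firstVarGrad gradU ε ρ, ?_, hL,
    fun ζ hζ => hL.ae_eq hconv hint hX hζ, hW, ht,
    fun ζ hζ hζt => hW.ae_eq_of_isTangent hconv hbdd hint hρC hζ ht hζt⟩
  · obtain ⟨L, hk, hkB⟩ := RegKL.exists_gaussKernel_c11On (d := d) hε hD0
    obtain ⟨_, hlog⟩ := RegKL.log_gaussConv_c11On hε hconv hD hk hkB hρC
    exact (hU'.integrable hconv hbdd hρC).add (hlog.integrable hconv hbdd hρC)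
  · obtain ⟨X, hXC, hXρ⟩ := hX
    obtain ⟨G, -, hG⟩ := hL.2 X hXC hXρ
    exact ⟨X, hXC, hXρ, hG.hasFDerivWithinAt.differentiableWithinAt⟩
  · intro f hf' x hx
    -- On `C` an arbitrary first variation differs from `firstVar` by a constant, so the two have
    -- the same relative gradient.
    have hsub := fun y (hy : y ∈ C) => hf'.sub_eq_sub hfv hy
    have h1 := (hf.hasGradient x hx).hasFDerivWithinAt.add_const
      (∫ y, f y ∂ρ - ∫ y, RegKL.firstVar U ε ρ y ∂ρ)
    exact h1.congr (fun y hy => by linarith [hsub y hy]) (by linarith [hsub x hx])
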